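/- Let $p,k\ge 1$ be integers. **Definitions.** An *increasing tree* on a finite set $V$ of ordered vertices is a tree with vertex set $V$, rooted at $\min V$, such that the vertices on every path starting at the root appear increasingly; it is *starlike* if every vertex other than the root has at most one child. A *$(p,k)$-distribution* puts balls $D_1,\dots,D_p$ into urns $x_0,\dots,x_{pk}$ such that every urn except $x_0$ contains at most one ball and $D_i$ is put into $x_j$ only if $\lceil j/k\rceil<i$. The *$(p,k)$-forest* related to such a distribution is a graph $F$ on $\{0,1,\dots,(p-1)k+1\}\cup\{r_1,\dots,r_{p-1}\}$ (the symbols $r_i$ count as smaller than every positive integer) that is a disjoint union of starlike increasing trees $(S_0,0),(S_1,r_1),\dots,(S_{p-1},r_{p-1})$, such that the children of $r_i$ are $(i-1)k+2,\dots,ik$ and, whenever the ball $D_v$ is in the urn $x_n$ ($n\ge 0$), $(v-1)k+1$ is a child of $n$. Let $\alpha_{pm}(k)$ be the coefficients in $$(x^kD)^p=x^{p(k-1)}\sum_{m=1}^p\alpha_{pm}(k)\,x^mD^m,\qquad D=\tfrac{d}{dx},$$ with $\alpha_{pm}(k)=0$ for $m=0$ and for $m>p$; let ${p\brack j}$ and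 ${j\brace m}$ be the (signless) Stirling numbers of the first and second kind, and let $0^0=1$. Consider the triples $(T,\mathcal C',S_0)$ where $T$ is an increasing tree on $\{0,1,\dots,p\}$, $\mathcal C'$ is a colouring of the edges of $T$ that gives colour $0$ to all edges at the root $0$ and a colour from $\{1,\dots,k-1\}$ to every other edge, and $S_0$ is a starlike increasing tree on the vertex set $\{0\}\cup\{(v-1)k+1 : v \text{ is a child of } 0 \text{ in } T\}$. Let $\Xi$ send a $(p,k)$-forest $F$ to $(T,\mathcal C',S_0)$, where $S_0$ is the component of $0$ in $F$; $T$ has, for $0\le i\le p-1$ and $1\le v\le p$, the edge $\{i,v\}$ whenever $(v-1)k+1\in V(S_i)$; and this edge receives colour $0$ if $i=0$, and for $i>0$ the colour $r\in\{1,\dots,k-1\}$ for which $(i-1)k+r+1$ is an ancestor of $(v-1)k+1$ in $S_i$. **Theorem.** (i) $\Xi$ is a bijection from the set of $(p,k)$-forests onto the set of all triples $(T,\mathcal C',S_0)$ as above. (ii) The relation "$F$ is related to $d$" is a bijection between $(p,k)$-distributions $d$ and $(p,k)$-forests $F$, and the number of balls in $x_0$ equals the number of children of $0$ in the component $S_0$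 of $\Xi(F)$. For $0\le j\le p$ and $m\ge 0$ there are exactly ${p\brack j}{j\brace m}(k-1)^{p-j}$ triples in which $0$ has $j$ children in $T$ and $m$ children in $S_0$. The coefficient $\alpha_{pm}(k)$ equals the number of $(p,k)$-distributions with exactly $m$ balls in $x_0$, and for all $m\ge0$ $$\alpha_{pm}(k)=\sum_{j=m}^{p}{p\brack j}{j\brace m}(k-1)^{p-j}.$$ -/

import Mathlib

open Polynomial

namespace PKForest

/-- A graph whose vertices are integers: a vertex set together with an adjacency relation on it. -/
abbrev Gr := (⊤ : SimpleGraph ℤ).Subgraph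

/-- `G` is an increasing tree rooted at `r`: a finite tree whose least vertex is `r`, and along
every path that starts at the root the vertices appear increasingly. -/
structure IsIncreasingTree (r : ℤ) (G : Gr) : Prop where
  finite : G.verts.Finite
  root : IsLeast G.verts r
  isTree : G.coe.IsTree
  increasing : ∀ (v : ℤ) (P : G.spanningCoe.Walk r v), P.IsPath → P.support.Pairwise (· < ·)

/-- In a graph all of whose components are increasing trees, the children of `u` are the
neighbours of `u` that are greater than `u`. -/
def IsChild (G : Gr) (u v : ℤ) : Prop := G.Adj u v ∧ u < v

/-- The number of children of `u`. -/
noncomputable def numChildren (G : Gr) (u : ℤ) : ℕ := {v : ℤ | IsChild G u v}.ncard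

/-- A starlike increasing tree rooted at `r`: an increasing tree in which every vertex, except
possibly the root, has at most one child. -/
structure IsStarlike (r : ℤ) (G : Gr) : Prop where
  isIncreasingTree : IsIncreasingTree r G
  starlike : ∀ u v w : ℤ, u ≠ r → IsChild G u v → IsChild G u w → v = w

/-- A `(p,k)`-distribution: the balls `D_i` with `1 ≤ i ≤ p` are put into the urns `x_j` with
`0 ≤ j ≤ pk`; every urn other than `x_0` holds at most one ball, and `D_i` may be put into `x_j`
only if `⌈j / k⌉ < i`. -/
structure Distribution (p k : ℕ) where
  urn : Finset.Icc 1 p → Finset.Icc 0 (p * k)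
  capacity : ∀ i i', (urn i : ℕ) ≠ 0 → urn i = urn i' → i = i'
  allowed : ∀ i, (urn i : ℕ) ⌈/⌉ k < (i : ℕ)

/-- The number of balls in the urn `x_0`. -/
noncomputable def Distribution.ballsInZero {p k : ℕ} (d : Distribution p k) : ℕ :=
  {i | (d.urn i : ℕ) = 0}.ncard

/-- The number of `(p,k)`-distributions in which the urn `x_0` holds exactly `m` balls. -/
noncomputable def alpha (p k m : ℕ) : ℕ :=
  {d : Distribution p k | d.ballsInZero = m}.ncard

/-- The vertex `(v-1)k+1` that belongs to the ball `D_v`. -/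
def ballVertex (k : ℕ) (v : ℤ) : ℤ := (v - 1) * k + 1

/-- The root symbols: `r_i` is represented by the integer `-i`, so that the `r_i` are smaller than
every positive integer. The vertex `0` is `rt 0`. -/
def rt (i : ℤ) : ℤ := -i

/-- The component `S_i` of `F` that contains `rt i` (so `S_0` is the component of `0`). -/
def comp (F : Gr) (i : ℤ) : Gr := F.induce {u | F.spanningCoe.Reachable (rt i) u}

/-- `F` is the `(p,k)`-forest related to the distribution `d`. -/
structure IsForestOf {p k : ℕ} (d : Distribution p k) (F : Gr) : Prop where
  /-- the vertex set is `{r_{p-1}, …, r_1} ∪ {0, 1, …, (p-1)k+1}` -/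
  verts : F.verts = Set.Icc (rt ((p : ℤ) - 1)) (((p : ℤ) - 1) * k + 1)
  /-- the components `S_0, …, S_{p-1}` are starlike increasing trees with roots `0`, `r_i` -/
  starlike : ∀ i ∈ Set.Icc (0 : ℤ) ((p : ℤ) - 1), IsStarlike (rt i) (comp F i)
  /-- `F` is their disjoint union -/
  disjoint : ∀ i ∈ Set.Icc (0 : ℤ) ((p : ℤ) - 1), ∀ j ∈ Set.Icc (0 : ℤ) ((p : ℤ) - 1), i ≠ j →
    Disjoint (comp F i).verts (comp F j).verts
  cover : ∀ u ∈ F.verts, ∃ i ∈ Set.Icc (0 : ℤ) ((p : ℤ) - 1), u ∈ (comp F i).verts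
  /-- the children of `r_i` are `(i-1)k+2, …, ik` -/
  children_rt : ∀ i ∈ Set.Icc (1 : ℤ) ((p : ℤ) - 1), ∀ u : ℤ,
    IsChild F (rt i) u ↔ u ∈ Set.Icc ((i - 1) * k + 2) (i * k)
  /-- if the ball `D_m` is put into `x_n` (also for `n = 0`), then `(m-1)k+1` is a child of `n` -/
  children_ball : ∀ m : Finset.Icc 1 p,
    IsChild F ((d.urn m : ℕ) : ℤ) (ballVertex k ((m : ℕ) : ℤ))

/-- The set of all `(p,k)`-forests. -/
def forests (p k : ℕ) : Set Gr := {F | ∃ d : Distribution p k, IsForestOf d F}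

/-- `u` is an ancestor of `w` in the component `S_i`: it lies on the path from the root to `w`. -/
def IsAncestor (F : Gr) (i u w : ℤ) : Prop :=
  ∃ P : F.spanningCoe.Walk (rt i) w, P.IsPath ∧ u ∈ P.support

/-- The edges `{i, v}` of the tree `T`: `0 ≤ i ≤ p-1`, `1 ≤ v ≤ p` and `(v-1)k+1 ∈ V(S_i)`. -/
def OmegaEdge (p k : ℕ) (F : Gr) (i v : ℤ) : Prop :=
  i ∈ Set.Icc (0 : ℤ) ((p : ℤ) - 1) ∧ v ∈ Set.Icc (1 : ℤ) p ∧ ballVertex k v ∈ (comp F i).verts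

/-- The edge `{i, v}` receives the colour `r`: root edges receive `0`, and for `i > 0` the edge
receives `r`, `1 ≤ r ≤ k-1`, if `(v-1)k+1` has the ancestor `(i-1)k+r+1` in `S_i`. -/
def OmegaColour (p k : ℕ) (F : Gr) (i v : ℤ) (r : ℕ) : Prop :=
  OmegaEdge p k F i v ∧
    ((i = 0 ∧ r = 0) ∨
      (0 < i ∧ 1 ≤ r ∧ r ≤ k - 1 ∧ IsAncestor F i ((i - 1) * k + r + 1) (ballVertex k v)))

/-- The tree `T` on `[0,p]` that is assigned to `F`. -/
def OmegaTree (p k : ℕ) (F : Gr) : Gr where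
  verts := Set.Icc (0 : ℤ) p
  Adj a b := a ≠ b ∧ (OmegaEdge p k F a b ∨ OmegaEdge p k F b a)
  adj_sub h := h.1
  edge_vert := by
    rintro a b ⟨-, ⟨h, -, -⟩ | ⟨-, h, -⟩⟩
    · exact ⟨h.1, by linarith [h.2]⟩
    · exact ⟨by linarith [h.1], h.2⟩
  symm := ⟨fun _ _ h => ⟨h.1.symm, h.2.symm⟩⟩

/-- A colouring of the edges of a graph, as a partial function: `none` off the edge set. -/
abbrev Colouring := Sym2 ℤ → Option ℕ

open Classical in
/-- The colouring of the edges of `OmegaTree p k F`. -/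
noncomputable def OmegaColouring (p k : ℕ) (F : Gr) : Colouring := fun e =>
  if h : ∃ r : ℕ, ∃ i v : ℤ, e = s(i, v) ∧ OmegaColour p k F i v r then some h.choose else none

/-- A tree, a colouring of its edges, and a second tree. -/
@[ext]
structure Triple where
  T : Gr
  colour : Colouring
  S : Gr

/-- The triples `(T, C', S_0)`. -/
structure IsTriple (p k : ℕ) (t : Triple) : Prop where
  /-- `T` is an increasing tree on `[0,p]` -/
  tree_verts : t.T.verts = Set.Icc (0 : ℤ) p
  tree : IsIncreasingTree 0 t.T
  /-- exactly the edges of `T` are coloured: edges at the root with `0`, the other ones with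
  `1, …, k-1` -/
  colour_none : ∀ e, e ∉ t.T.edgeSet → t.colour e = none
  colour_root : ∀ e ∈ t.T.edgeSet, (0 : ℤ) ∈ e → t.colour e = some 0
  colour_other : ∀ e ∈ t.T.edgeSet, (0 : ℤ) ∉ e → ∃ r : ℕ, 1 ≤ r ∧ r ≤ k - 1 ∧ t.colour e = some r
  /-- `S_0` is a starlike increasing tree on `0` and the vertices `(v-1)k+1`, where `v` runs over
  the children of `0` in `T` -/
  star_verts : t.S.verts = insert 0 (ballVertex k '' {v | IsChild t.T 0 v})
  star : IsStarlike 0 t.S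

/-- The set of all triples. -/
def triples (p k : ℕ) : Set Triple := {t | IsTriple p k t}

/-- The map `Ξ`: a forest is sent to its coloured tree and to its component `S_0`. -/
noncomputable def Xi (p k : ℕ) (F : Gr) : Triple :=
  ⟨OmegaTree p k F, OmegaColouring p k F, comp F 0⟩

/-- The operator `x^k D` on real polynomials. -/
noncomputable def xkD (k : ℕ) (f : ℝ[X]) : ℝ[X] := X ^ k * derivative f

/-- The numbers `a_1, …, a_p` are the coefficients in
`(x^k D)^p = x^{p(k-1)} ∑_{m=1}^p a_m x^m D^m`. -/
def IsExpansion (p k : ℕ) (a : ℕ → ℝ) : Prop :=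
  ∀ f : ℝ[X], (xkD k)^[p] f =
    X ^ (p * (k - 1)) * ∑ m ∈ Finset.Icc 1 p, C (a m) * X ^ m * derivative^[m] f

end PKForest

namespace PKForest

open SimpleGraph Relation

/-! Number the balls from `0`, so that ball `v` owns the vertex `vk+1`. A distribution becomes a
function `f` with `f v ≤ vk` that repeats no nonzero value on `v < p`. A finite graph is an
increasing tree exactly when every vertex except the least one has a unique smaller neighbour
(`isIncreasingTree_iff`). So the related forest is fixed by its parent relation (`isForestOf_iff`):
`f` gives the parents of ball vertices, the symbols `r_i` are the parents of the others.

Follow parents upward from `vk+1`. The chain runs through ball vertices until it meets `0` or a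
coloured vertex `n = ik+r+1`, `1 ≤ r < k`, whose parent is `r_{i+1}`. In the second case `T` joins
`v+1` to `i+1` with colour `r`, so `Ξ` remembers `n`; in the first case `S_0` remembers `f v`. `code
k f` records exactly this, and triples correspond to the functions satisfying `IsCode`. It remains
to see that `f ↦ code k f` is bijective: balls with the same coloured end `n` form one increasing
chain below `n`, so `f` sends the least of them to `n` and each other one to the vertex of its
predecessor (`code_injOn`, `IsCode.exists_urnFun`).

To count, extend a code of length `p` with degrees `j` in `T` and `m` in `S_0` by one value: one of
`p(k-1)` coloured vertices (degrees unchanged), `0` (both grow), or the leaf of one of the `m`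
branches of `S_0` (only `j` grows). The Stirling product obeys the same recurrence (`card_codes`).
Summed over `j`, it becomes the recurrence of the coefficients of `(x^k D)^p`
(`stirlingSum_succ_succ`, `xkD_term`), which are unique. -/

/-! ### Increasing trees through smaller neighbours -/

theorem ext_of_isChild {G H : Gr} (hv : G.verts = H.verts)
    (hc : ∀ u v, IsChild G u v ↔ IsChild H u v) : G = H := by
  refine SimpleGraph.Subgraph.ext hv ?_
  ext a b
  rcases lt_trichotomy a b with h | rfl | h
  · have := hc a b
    simpa [IsChild, h] using this
  · exact iff_of_false (fun h => h.ne rfl) (fun h => h.ne rfl)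
  · have := hc b a
    simpa [IsChild, h, G.adj_comm, H.adj_comm] using this

theorem IsChild.mem_left {G : Gr} {u v : ℤ} (h : IsChild G u v) : u ∈ G.verts :=
  G.edge_vert h.1

theorem IsChild.mem_right {G : Gr} {u v : ℤ} (h : IsChild G u v) : v ∈ G.verts :=
  G.edge_vert h.1.symm

theorem adj_iff_isChild {G : Gr} {u v : ℤ} : G.Adj u v ↔ IsChild G u v ∨ IsChild G v u := by
  constructor
  · intro h
    rcases lt_or_gt_of_ne h.ne with h' | h'
    · exact Or.inl ⟨h, h'⟩
    · exact Or.inr ⟨h.symm, h'⟩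
  · rintro (h | h)
    · exact h.1
    · exact h.1.symm

/-- A path that avoids the lower neighbours of its first vertex is increasing, if every vertex has
at most one lower neighbour. -/
theorem pairwise_lt_support {G : Gr}
    (hG : ∀ u u' v, IsChild G u v → IsChild G u' v → u = u') {u v : ℤ}
    (P : G.spanningCoe.Walk u v) (hP : P.IsPath) (h : ∀ w ∈ P.support, ¬ IsChild G w u) :
    P.support.Pairwise (· < ·) := by
  induction P with
  | nil => simp
  | @cons u b v e q ih =>
    rw [Walk.cons_isPath_iff] at hP
    have he : G.Adj u b := e
    have hub : IsChild G u b := by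
      rcases adj_iff_isChild.1 he with h' | h'
      · exact h'
      · exact absurd h' (h b (by simp))
    -- `u` is the only smaller neighbour of `b` and the path does not return to it, so the tail
    -- again avoids the smaller neighbours of its start.
    have hq := ih hP.1 (fun w hw hwb => hP.2 (hG _ _ _ hub hwb ▸ hw))
    rw [Walk.support_cons, List.pairwise_cons]
    refine ⟨fun w hw => ?_, hq⟩
    rw [← Walk.cons_tail_support, List.pairwise_cons] at hq
    rw [← Walk.cons_tail_support, List.mem_cons] at hw
    rcases hw with rfl | hw
    · exact hub.2
    · exact hub.2.trans (hq.1 w hw)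

theorem mem_support_bounds {G : SimpleGraph ℤ} {u v : ℤ} (P : G.Walk u v)
    (h : P.support.Pairwise (· < ·)) : ∀ w ∈ P.support, u ≤ w ∧ w ≤ v := by
  induction P with
  | nil => simp
  | @cons u b v e q ih =>
    rw [Walk.support_cons, List.pairwise_cons] at h
    have hb := h.1 b q.start_mem_support
    intro w hw
    rw [Walk.support_cons, List.mem_cons] at hw
    rcases hw with rfl | hw
    · exact ⟨le_rfl, hb.le.trans (ih h.2 b q.start_mem_support).2⟩
    · exact ⟨hb.le.trans (ih h.2 w hw).1, (ih h.2 w hw).2⟩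

/-- Forwards, the smaller neighbour of `v` is the last but one vertex of the path from the root; a
second one would give a second path. Backwards, descent to smaller neighbours reaches the root, and
the largest vertex of a cycle would have two smaller neighbours. -/
theorem isIncreasingTree_iff {r : ℤ} {G : Gr} :
    IsIncreasingTree r G ↔ G.verts.Finite ∧ IsLeast G.verts r ∧
      ∀ v ∈ G.verts, v ≠ r → ∃! u, IsChild G u v := by
  constructor
  · intro hG
    refine ⟨hG.finite, hG.root, fun v hv hvr => ?_⟩
    let φ : G.coe →g G.spanningCoe := ⟨Subtype.val, fun h => h⟩
    have hφ : Function.Injective φ := Subtype.val_injective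
    have key : ∀ u (hu : u ∈ G.verts), ∃ P : G.coe.Walk ⟨r, hG.root.1⟩ ⟨u, hu⟩, P.IsPath ∧
        (P.map φ).support.Pairwise (· < ·) := by
      intro u hu
      obtain ⟨P, hP⟩ := hG.isTree.connected.preconnected.exists_isPath ⟨r, hG.root.1⟩ ⟨u, hu⟩
      exact ⟨P, hP, hG.increasing _ _ (hP.map hφ)⟩
    obtain ⟨P, hP, hPi⟩ := key v hv
    have hnil : ¬ P.Nil := fun h => hvr (congrArg Subtype.val h.eq).symm
    have hadj := P.adj_penultimate hnil
    refine ⟨P.penultimate.1, ⟨hadj, ?_⟩, ?_⟩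
    · have h1 := mem_support_bounds _ hPi P.penultimate.1 (by
        rw [Walk.support_map]
        exact List.mem_map_of_mem (f := φ) (P.getVert_mem_support _))
      exact lt_of_le_of_ne h1.2 (fun h => hadj.ne (Subtype.ext h))
    · intro u hu
      obtain ⟨Q, hQ, hQi⟩ := key u hu.mem_left
      have hvQ : ⟨v, hv⟩ ∉ Q.support := by
        intro h
        have h1 := mem_support_bounds _ hQi v (by
          rw [Walk.support_map]
          exact List.mem_map_of_mem (f := φ) h)
        exact absurd hu.2 (not_lt.2 h1.2)
      -- The path to `u` stays `≤ u < v`, so appending `v` gives a path, which acyclicity identifies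
      -- with `P`.
      have hQ' : (Q.concat (show G.coe.Adj ⟨u, hu.mem_left⟩ ⟨v, hv⟩ from hu.1)).IsPath :=
        hQ.concat hvQ _
      have h2 := congrArg Subtype.val ((hG.isTree.isAcyclic.subsingleton_path _ _).elim ⟨_, hQ'⟩ ⟨P, hP⟩)
      simp only at h2
      rw [← h2]
      simp
  · rintro ⟨hfin, hroot, hpar⟩
    have huniq : ∀ u u' v, IsChild G u v → IsChild G u' v → u = u' := by
      intro u u' v h h'
      have hv : v ≠ r := fun e => absurd h.2 (not_lt.2 (e ▸ hroot.2 h.mem_left))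
      exact (hpar v h.mem_right hv).unique h h'
    refine ⟨hfin, hroot, ⟨?_, ?_⟩, ?_⟩
    · have hreach : ∀ n : ℕ, ∀ v (hv : v ∈ G.verts), v - r ≤ n →
          G.coe.Reachable ⟨r, hroot.1⟩ ⟨v, hv⟩ := by
        intro n
        induction n with
        | zero =>
          intro v hv hn
          have : v = r := le_antisymm (by simpa using hn) (hroot.2 hv)
          subst this
          rfl
        | succ n ih =>
          intro v hv hn
          by_cases hvr : v = r
          · subst hvr
            rfl
          · obtain ⟨u, hu, -⟩ := hpar v hv hvr
            have h1 := ih u hu.mem_left (by have := hu.2; push_cast at hn; omega)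
            exact h1.trans (Adj.reachable (show G.coe.Adj ⟨u, hu.mem_left⟩ ⟨v, hv⟩ from hu.1))
      have hreach' : ∀ v : G.verts, G.coe.Reachable ⟨r, hroot.1⟩ v := fun v =>
        hreach (v.1 - r).toNat v.1 v.2 (Int.self_le_toNat _)
      have : Nonempty G.verts := ⟨⟨r, hroot.1⟩⟩
      exact ⟨fun a b => (hreach' a).symm.trans (hreach' b)⟩
    · intro x c hc
      obtain ⟨m, hm, hmax⟩ := Finset.exists_max_image c.support.toFinset (fun v => v.1)
        ⟨x, by simp⟩
      rw [List.mem_toFinset] at hm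
      have hmax' : ∀ y ∈ (c.rotate m hm).support, y.1 ≤ m.1 := by
        intro y hy
        apply hmax
        simpa using hy
      -- Started at its largest vertex, the cycle leaves and returns through two different smaller
      -- neighbours.
      have hc' := hc.rotate hm
      have hnil := hc'.not_nil
      apply hc'.snd_ne_penultimate
      have h1 := (c.rotate m hm).adj_snd hnil
      have h2 := (c.rotate m hm).adj_penultimate hnil
      refine Subtype.ext (huniq _ _ m.1 ⟨h1.symm, ?_⟩ ⟨h2, ?_⟩)
      · exact lt_of_le_of_ne (hmax' _ (Walk.getVert_mem_support _ _))
          (fun h => h1.ne (Subtype.ext h).symm)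
      · exact lt_of_le_of_ne (hmax' _ (Walk.getVert_mem_support _ _))
          (fun h => h2.ne (Subtype.ext h))
    · intro v P hP
      exact pairwise_lt_support huniq P hP fun w _ hw =>
        absurd hw.2 (not_lt.2 (hroot.2 hw.mem_left))

theorem isStarlike_iff {r : ℤ} {G : Gr} :
    IsStarlike r G ↔ (G.verts.Finite ∧ IsLeast G.verts r ∧
      ∀ v ∈ G.verts, v ≠ r → ∃! u, IsChild G u v) ∧
      ∀ u v w : ℤ, u ≠ r → IsChild G u v → IsChild G u w → v = w := by
  rw [← isIncreasingTree_iff]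
  exact ⟨fun h => ⟨h.1, h.2⟩, fun h => ⟨h.1, h.2⟩⟩

/-! ### Components, and graphs given by a parent relation -/

theorem mem_comp {F : Gr} {i u : ℤ} :
    u ∈ (comp F i).verts ↔ F.spanningCoe.Reachable (rt i) u := Iff.rfl

theorem IsChild.reachable {F : Gr} {u v : ℤ} (h : IsChild F u v) :
    F.spanningCoe.Reachable u v :=
  Adj.reachable (show F.spanningCoe.Adj u v from h.1)

theorem isChild_comp {F : Gr} {i u v : ℤ} :
    IsChild (comp F i) u v ↔ F.spanningCoe.Reachable (rt i) u ∧ IsChild F u v := by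
  constructor
  · rintro ⟨⟨h1, h2, h3⟩, h⟩
    exact ⟨h1, h3, h⟩
  · rintro ⟨h1, h⟩
    exact ⟨⟨h1, h1.trans h.reachable, h.1⟩, h.2⟩

/-- The graph on `V` in which the lower neighbours are given by the relation `C`. -/
def ofChild (V : Set ℤ) (C : ℤ → ℤ → Prop) : Gr where
  verts := V
  Adj a b := a ∈ V ∧ b ∈ V ∧ (a < b ∧ C a b ∨ b < a ∧ C b a)
  adj_sub := by
    rintro a b ⟨-, -, h | h⟩
    · exact h.1.ne
    · exact h.1.ne'
  edge_vert h := h.1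
  symm := ⟨fun _ _ h => ⟨h.2.1, h.1, h.2.2.symm⟩⟩

theorem isChild_ofChild {V : Set ℤ} {C : ℤ → ℤ → Prop} {a b : ℤ} :
    IsChild (ofChild V C) a b ↔ a ∈ V ∧ b ∈ V ∧ a < b ∧ C a b := by
  constructor
  · rintro ⟨⟨ha, hb, h | h⟩, hab⟩
    · exact ⟨ha, hb, h⟩
    · exact absurd h.1 hab.not_gt
  · rintro ⟨ha, hb, hab, h⟩
    exact ⟨⟨ha, hb, Or.inl ⟨hab, h⟩⟩, hab⟩

/-! ### Distributions as functions -/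

/-- Distributions as functions on `ℕ`: `f v` is the urn of the ball `D_{v+1}`. -/
structure IsUrnFun (p k : ℕ) (f : ℕ → ℕ) : Prop where
  le : ∀ v < p, f v ≤ v * k
  inj : ∀ v < p, ∀ w < p, f v ≠ 0 → f v = f w → v = w
  zero : ∀ v, p ≤ v → f v = 0

/-- The urn of the ball `D_{v+1}`. -/
def Distribution.toFun {p k : ℕ} (d : Distribution p k) (v : ℕ) : ℕ :=
  if h : v + 1 ∈ Finset.Icc 1 p then d.urn ⟨v + 1, h⟩ else 0

theorem Distribution.toFun_eq {p k : ℕ} (d : Distribution p k) {v : ℕ}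
    (h : v + 1 ∈ Finset.Icc 1 p) : d.toFun v = d.urn ⟨v + 1, h⟩ := dif_pos h

theorem Distribution.isUrnFun {p k : ℕ} (hk : 0 < k) (d : Distribution p k) :
    IsUrnFun p k d.toFun where
  le v hv := by
    have h : v + 1 ∈ Finset.Icc 1 p := Finset.mem_Icc.2 ⟨by omega, by omega⟩
    rw [d.toFun_eq h]
    have := d.allowed ⟨v + 1, h⟩
    rw [Nat.lt_succ_iff, ceilDiv_le_iff_le_mul hk] at this
    exact this.trans_eq (mul_comm k v)
  inj v hv w hw h0 he := by
    have h : v + 1 ∈ Finset.Icc 1 p := Finset.mem_Icc.2 ⟨by omega, by omega⟩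
    have h' : w + 1 ∈ Finset.Icc 1 p := Finset.mem_Icc.2 ⟨by omega, by omega⟩
    rw [d.toFun_eq h] at h0 he
    rw [d.toFun_eq h'] at he
    have := d.capacity _ _ h0 (Subtype.ext he)
    simpa using this
  zero v hv := dif_neg (by simp; omega)

theorem Distribution.toFun_injective {p k : ℕ} :
    Function.Injective (Distribution.toFun (p := p) (k := k)) := by
  rintro ⟨f, hf, hf'⟩ ⟨g, hg, hg'⟩ h
  congr 1
  ext ⟨v, hv⟩
  obtain ⟨w, rfl⟩ : ∃ w, v = w + 1 := ⟨v - 1, by have := (Finset.mem_Icc.1 hv).1; omega⟩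
  have := congrFun h w
  rwa [toFun_eq _ hv, toFun_eq _ hv] at this

theorem IsUrnFun.exists_distribution {p k : ℕ} (hk : 0 < k) {f : ℕ → ℕ} (hf : IsUrnFun p k f) :
    ∃ d : Distribution p k, d.toFun = f := by
  have hlt : ∀ i : Finset.Icc 1 p, (i : ℕ) - 1 < p := fun i => by
    have := Finset.mem_Icc.1 i.2
    omega
  refine ⟨⟨fun i => ⟨f (i - 1), ?_⟩, ?_, ?_⟩, ?_⟩
  · exact Finset.mem_Icc.2 ⟨by omega, (hf.le _ (hlt i)).trans
      (Nat.mul_le_mul_right k (hlt i).le)⟩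
  · intro i j h0 he
    have h := hf.inj _ (hlt i) _ (hlt j) h0 (congrArg Subtype.val he)
    have h1 := Finset.mem_Icc.1 i.2
    have h2 := Finset.mem_Icc.1 j.2
    exact Subtype.ext (by omega)
  · intro i
    have h1 := Finset.mem_Icc.1 i.2
    have h := hf.le _ (hlt i)
    have h3 : f (i - 1) ⌈/⌉ k ≤ (i : ℕ) - 1 := by rwa [ceilDiv_le_iff_le_mul hk, mul_comm]
    simp only
    omega
  · ext v
    by_cases hv : v < p
    · rw [Distribution.toFun_eq _ (Finset.mem_Icc.2 ⟨by omega, by omega⟩)]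
      simp
    · rw [hf.zero v (by omega)]
      exact dif_neg (by simp; omega)

theorem Distribution.ballsInZero_eq {p k : ℕ} (d : Distribution p k) :
    d.ballsInZero = ((Finset.range p).filter fun v => d.toFun v = 0).card := by
  rw [← Set.ncard_coe_finset]
  refine Set.ncard_congr (fun i _ => (i : ℕ) - 1) ?_ ?_ ?_
  · rintro ⟨i, hi⟩ h
    obtain ⟨w, rfl⟩ : ∃ w, i = w + 1 := ⟨i - 1, by have := (Finset.mem_Icc.1 hi).1; omega⟩
    have := Finset.mem_Icc.1 hi
    simp only [add_tsub_cancel_right, Finset.coe_filter, Finset.mem_range, Set.mem_ofPred_eq]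
    exact ⟨by omega, by rw [d.toFun_eq hi]; exact h⟩
  · rintro ⟨i, hi⟩ ⟨j, hj⟩ _ _ h
    have h1 := Finset.mem_Icc.1 hi
    have h2 := Finset.mem_Icc.1 hj
    simp only at h
    exact Subtype.ext (by simp only; omega)
  · intro v hv
    simp only [Finset.coe_filter, Finset.mem_range, Set.mem_ofPred_eq] at hv
    have h : v + 1 ∈ Finset.Icc 1 p := Finset.mem_Icc.2 ⟨by omega, by omega⟩
    refine ⟨⟨v + 1, h⟩, ?_, by simp⟩
    have := hv.2
    rwa [d.toFun_eq h] at this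

/-! ### Forests through their parent relation -/

theorem mul_add_unique {k i r j s : ℕ} (hr : r < k) (hs : s < k) (h : i * k + r = j * k + s) :
    i = j ∧ r = s := by
  have h1 := congrArg (· / k) h
  have h2 := congrArg (· % k) h
  simp only [Nat.mul_add_mod_self_right, Nat.mod_eq_of_lt hr, Nat.mod_eq_of_lt hs] at h2
  have hk : 0 < k := by omega
  subst h2
  exact ⟨Nat.eq_of_mul_eq_mul_right hk (by omega), rfl⟩

/-- The child relation of the forest related to the distribution `f`. -/
def ForestChild (p k : ℕ) (f : ℕ → ℕ) (a b : ℤ) : Prop :=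
  (∃ v < p, b = ((v * k + 1 : ℕ) : ℤ) ∧ a = (f v : ℤ)) ∨
    ∃ i r : ℕ, i + 1 < p ∧ 1 ≤ r ∧ r < k ∧ b = ((i * k + r + 1 : ℕ) : ℤ) ∧ a = -((i : ℤ) + 1)

theorem ForestChild.bounds {p k : ℕ} {f : ℕ → ℕ} (hf : IsUrnFun p k f)
    {a b : ℤ} (h : ForestChild p k f a b) :
    1 - (p : ℤ) ≤ a ∧ a < b ∧ 0 < b ∧ b ≤ ((p : ℤ) - 1) * k + 1 := by
  rcases h with ⟨v, hv, rfl, rfl⟩ | ⟨i, r, hi, hr, hrk, rfl, rfl⟩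
  · have := hf.le v hv
    have h2 : v * k ≤ (p - 1) * k := Nat.mul_le_mul_right k (by omega)
    zify [show 1 ≤ p by omega] at *
    refine ⟨by omega, by omega, by positivity, by linarith⟩
  · have h2 : (i + 1) * k ≤ (p - 1) * k := Nat.mul_le_mul_right k (by omega)
    rw [add_mul] at h2
    zify [show 1 ≤ p by omega] at *
    have h3 : (0 : ℤ) ≤ i * k := by positivity
    refine ⟨by omega, by omega, by omega, by linarith⟩

/-- Division of `b - 1` by `k` decides the parent: remainder `0` makes `b` the vertex of a ball, any
other remainder a child of the root symbol given by the quotient. -/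
theorem ForestChild.unique {p k : ℕ} {f : ℕ → ℕ} (hk : 0 < k) {a a' b : ℤ}
    (h : ForestChild p k f a b) (h' : ForestChild p k f a' b) : a = a' := by
  rcases h with ⟨v, hv, rfl, rfl⟩ | ⟨i, r, hi, hr, hrk, rfl, rfl⟩ <;>
  rcases h' with ⟨w, hw, hb, rfl⟩ | ⟨j, s, hj, hs, hsk, hb, rfl⟩
  · obtain ⟨rfl, -⟩ := mul_add_unique (k := k) (i := v) (j := w) hk hk (by omega)
    rfl
  · have := mul_add_unique (k := k) (i := v) (j := j) hk hsk (by omega)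
    omega
  · have := mul_add_unique (k := k) (i := i) (j := w) hrk hk (by omega)
    omega
  · have := mul_add_unique (k := k) (i := i) (j := j) hrk hsk (by omega)
    omega

theorem exists_forestChild {p k : ℕ} (f : ℕ → ℕ) (hp : 0 < p) (hk : 0 < k) {b : ℤ} (hb : 0 < b)
    (hb' : b ≤ ((p : ℤ) - 1) * k + 1) : ∃ a, ForestChild p k f a b := by
  obtain ⟨n, rfl⟩ : ∃ n : ℕ, b = ((n + 1 : ℕ) : ℤ) := ⟨(b - 1).toNat, by omega⟩
  have hn : n ≤ (p - 1) * k := by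
    zify [show 1 ≤ p by omega]
    push_cast at hb'
    linarith
  have hd := Nat.div_add_mod' n k
  by_cases hr : n % k = 0
  · refine ⟨f (n / k), Or.inl ⟨n / k, ?_, by omega, rfl⟩⟩
    have := Nat.div_le_of_le_mul (m := n) (k := k) (n := p - 1) (by rwa [mul_comm])
    omega
  · refine ⟨-((n / k : ℕ) + 1 : ℤ), Or.inr ⟨n / k, n % k, ?_, by omega, Nat.mod_lt _ hk, by omega,
      rfl⟩⟩
    have : n / k < p - 1 := by
      rw [Nat.div_lt_iff_lt_mul hk]
      -- The last vertex `(p-1)k+1` belongs to a ball, so a nonzero remainder excludes it.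
      refine lt_of_le_of_ne hn fun h => hr ?_
      rw [h, Nat.mul_mod_left]
    omega

/-- The forest related to the distribution `f`, described by its child relation. -/
structure IsLocalForest (p k : ℕ) (f : ℕ → ℕ) (F : Gr) : Prop where
  verts : F.verts = Set.Icc (1 - (p : ℤ)) (((p : ℤ) - 1) * k + 1)
  child : ∀ a b, IsChild F a b ↔ ForestChild p k f a b

theorem IsUrnFun.exists_isLocalForest {p k : ℕ} {f : ℕ → ℕ} (hf : IsUrnFun p k f) :
    ∃ F, IsLocalForest p k f F := by
  refine ⟨ofChild (Set.Icc (1 - (p : ℤ)) (((p : ℤ) - 1) * k + 1)) (ForestChild p k f), rfl,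
    fun a b => ?_⟩
  rw [isChild_ofChild]
  refine ⟨fun h => h.2.2.2, fun h => ?_⟩
  obtain ⟨h1, h2, h3, h4⟩ := h.bounds hf
  exact ⟨⟨h1, by linarith⟩, ⟨by linarith, h4⟩, h2, h⟩

theorem IsLocalForest.unique {p k : ℕ} {f : ℕ → ℕ} {F F' : Gr} (h : IsLocalForest p k f F)
    (h' : IsLocalForest p k f F') : F = F' :=
  ext_of_isChild (h.verts.trans h'.verts.symm) fun a b => (h.child a b).trans (h'.child a b).symm

/-- `spanningCoe` has every integer as a vertex, and each reaches itself; only a nontrivial walk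
certifies membership. -/
theorem mem_verts_of_reachable {F : Gr} {u v : ℤ} (h : F.spanningCoe.Reachable u v)
    (hvu : v ≠ u) : v ∈ F.verts := by
  obtain ⟨P⟩ := h
  have hnil : ¬ P.Nil := fun hn => hvu hn.eq.symm
  exact F.edge_vert (show F.Adj _ _ from P.adj_penultimate hnil).symm

section LocalForest

variable {p k : ℕ} {f : ℕ → ℕ} {F : Gr}

theorem IsLocalForest.lower_unique (hk : 0 < k) (h : IsLocalForest p k f F) (u u' v : ℤ)
    (hu : IsChild F u v) (hu' : IsChild F u' v) : u = u' :=
  ((h.child _ _).1 hu).unique hk ((h.child _ _).1 hu')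

theorem IsLocalForest.increasing (hk : 0 < k) (hf : IsUrnFun p k f) (h : IsLocalForest p k f F)
    {u v : ℤ} (hu : u ≤ 0) (P : F.spanningCoe.Walk u v) (hP : P.IsPath) :
    P.support.Pairwise (· < ·) :=
  pairwise_lt_support (h.lower_unique hk) P hP fun _ _ hw =>
    absurd (((h.child _ _).1 hw).bounds hf).2.2.1 hu.not_gt

theorem IsLocalForest.le_of_reachable (hk : 0 < k) (hf : IsUrnFun p k f)
    (h : IsLocalForest p k f F) {u v : ℤ} (hu : u ≤ 0) (hv : F.spanningCoe.Reachable u v) :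
    u ≤ v := by
  obtain ⟨P, hP⟩ := hv.exists_isPath
  exact (mem_support_bounds P (h.increasing hk hf hu P hP) v P.end_mem_support).1

/-- A nonpositive vertex has no parent, so paths from it increase and it is least in its component;
two such vertices bound each other. -/
theorem IsLocalForest.root_unique (hk : 0 < k) (hf : IsUrnFun p k f)
    (h : IsLocalForest p k f F) {u u' v : ℤ} (hu : u ≤ 0) (hu' : u' ≤ 0)
    (hv : F.spanningCoe.Reachable u v) (hv' : F.spanningCoe.Reachable u' v) : u = u' :=
  le_antisymm (h.le_of_reachable hk hf hu (hv.trans hv'.symm))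
    (h.le_of_reachable hk hf hu' (hv'.trans hv.symm))

theorem IsLocalForest.exists_root (hp : 0 < p) (hk : 0 < k)
    (h : IsLocalForest p k f F) {u : ℤ} (hu : u ∈ F.verts) :
    ∃ i ∈ Set.Icc (0 : ℤ) ((p : ℤ) - 1), F.spanningCoe.Reachable (rt i) u := by
  have key : ∀ n : ℕ, ∀ u ∈ F.verts, u ≤ n →
      ∃ i ∈ Set.Icc (0 : ℤ) ((p : ℤ) - 1), F.spanningCoe.Reachable (rt i) u := by
    intro n
    induction n with
    | zero =>
      intro u hu hn
      rw [h.verts] at hu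
      refine ⟨-u, ⟨by simpa using hn, by linarith [hu.1]⟩, ?_⟩
      rw [rt, neg_neg]
    | succ n ih =>
      intro u hu hn
      by_cases hn' : u ≤ n
      · exact ih u hu hn'
      · have hu' := hu
        rw [h.verts] at hu'
        obtain ⟨a, ha⟩ := exists_forestChild f hp hk (b := u) (by omega) hu'.2
        have hc := (h.child _ _).2 ha
        obtain ⟨i, hi, hr⟩ := ih a hc.mem_left (by have := hc.2; push_cast at hn; omega)
        exact ⟨i, hi, hr.trans hc.reachable⟩
  exact key u.toNat u hu (Int.self_le_toNat u)

/-- A non-root vertex of a component is positive. Its children are then ball vertices, one for each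
ball in the urn of that number, which holds at most one. -/
theorem IsLocalForest.isStarlike_comp (hp : 0 < p) (hk : 0 < k) (hf : IsUrnFun p k f)
    (h : IsLocalForest p k f F) {i : ℤ} (hi : i ∈ Set.Icc (0 : ℤ) ((p : ℤ) - 1)) :
    IsStarlike (rt i) (comp F i) := by
  have hi0 : rt i ≤ 0 := by have := hi.1; simp only [rt]; omega
  have hsub : (comp F i).verts ⊆ F.verts := by
    intro u hu
    rw [mem_comp] at hu
    by_cases he : u = rt i
    · rw [he, h.verts]
      refine ⟨by have := hi.2; simp only [rt]; omega, hi0.trans ?_⟩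
      have : (0 : ℤ) ≤ ((p : ℤ) - 1) * k := mul_nonneg (by omega) (by omega)
      omega
    · exact mem_verts_of_reachable hu he
  rw [isStarlike_iff]
  refine ⟨⟨?_, ⟨?_, ?_⟩, ?_⟩, ?_⟩
  · refine Set.Finite.subset ?_ hsub
    rw [h.verts]
    exact Set.finite_Icc _ _
  · exact Reachable.refl _
  · intro u hu
    exact h.le_of_reachable hk hf hi0 hu
  · intro v hv hvi
    have hv' := hsub hv
    rw [h.verts] at hv'
    have hv0 : 0 < v := by
      by_contra hv0
      exact hvi (h.root_unique hk hf hi0 (by omega) hv (Reachable.refl v)).symm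
    obtain ⟨a, ha⟩ := exists_forestChild f hp hk hv0 hv'.2
    have hc := (h.child _ _).2 ha
    refine ⟨a, isChild_comp.2 ⟨(mem_comp.1 hv).trans hc.reachable.symm, hc⟩, fun u hu => ?_⟩
    exact h.lower_unique hk _ _ _ (isChild_comp.1 hu).2 hc
  · intro u v w hu hv hw
    rw [isChild_comp] at hv hw
    have hu0 : 0 < u := by
      by_contra hu0
      exact hu (h.root_unique hk hf hi0 (by omega) hv.1 (Reachable.refl u)).symm
    have h1 := (h.child _ _).1 hv.2
    have h2 := (h.child _ _).1 hw.2
    rcases h1 with ⟨x, hx, rfl, hx'⟩ | ⟨i, r, -, -, -, -, h1⟩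
    · rcases h2 with ⟨y, hy, rfl, hy'⟩ | ⟨i, r, -, -, -, -, h2⟩
      · rw [hf.inj x hx y hy (by omega) (by omega)]
      · omega
    · omega

end LocalForest

theorem ballVertex_succ (k v : ℕ) : ballVertex k ((v + 1 : ℕ) : ℤ) = ((v * k + 1 : ℕ) : ℤ) := by
  simp [ballVertex]

/-- `IsForestOf` does not directly exclude further edges. They are excluded because a nonpositive
vertex is the root of its own component, hence nobody's child, and a positive vertex already has a
listed parent, unique in a tree. -/
theorem isForestOf_iff {p k : ℕ} (hp : 0 < p) (hk : 0 < k) {d : Distribution p k} {F : Gr} :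
    IsForestOf d F ↔ IsLocalForest p k d.toFun F := by
  have hf := d.isUrnFun hk
  constructor
  · intro h
    have hverts : F.verts = Set.Icc (1 - (p : ℤ)) (((p : ℤ) - 1) * k + 1) := by
      rw [h.verts, rt, neg_sub]
    have hrt : ∀ {a b}, ForestChild p k d.toFun a b → IsChild F a b := by
      rintro a b (⟨v, hv, rfl, rfl⟩ | ⟨i, r, hi, hr, hrk, rfl, rfl⟩)
      · have hv' : v + 1 ∈ Finset.Icc 1 p := Finset.mem_Icc.2 ⟨by omega, by omega⟩
        have := h.children_ball ⟨v + 1, hv'⟩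
        rwa [ballVertex_succ, ← d.toFun_eq hv'] at this
      · refine (h.children_rt (i + 1) ⟨by omega, by omega⟩ _).2 ?_
        push_cast
        constructor <;> [skip; rw [add_mul]] <;> ring_nf <;> omega
    refine ⟨hverts, fun a b => ⟨fun hc => ?_, hrt⟩⟩
    obtain ⟨i, hi, ha⟩ := h.cover a hc.mem_left
    have hb := hc.mem_right
    rw [hverts] at hb
    have hst := (isStarlike_iff.1 (h.starlike i hi)).1
    have hcc : IsChild (comp F i) a b := isChild_comp.2 ⟨ha, hc⟩
    have hbi : b ≠ rt i := fun e => absurd hcc.2 (not_lt.2 (e ▸ hst.2.1.2 hcc.mem_left))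
    have hb0 : 0 < b := by
      by_contra hb0
      -- A vertex `b ≤ 0` is `rt (-b)`, so it would lie both in its own component and in that of
      -- `a`.
      refine Set.disjoint_left.1 (h.disjoint i hi (-b) ⟨by omega, by linarith [hb.1]⟩ ?_)
        hcc.mem_right ?_
      · rintro rfl
        exact hbi (by simp [rt])
      · rw [mem_comp, rt, neg_neg]
    obtain ⟨a', ha'⟩ := exists_forestChild d.toFun hp hk hb0 hb.2
    have hc' := hrt ha'
    have hcc' : IsChild (comp F i) a' b :=
      isChild_comp.2 ⟨(mem_comp.1 hcc.mem_right).trans hc'.reachable.symm, hc'⟩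
    rwa [(hst.2.2 b hcc.mem_right hbi).unique hcc hcc']
  · intro h
    refine ⟨?_, fun i hi => h.isStarlike_comp hp hk hf hi, ?_, fun u hu => ?_, ?_, ?_⟩
    · rw [h.verts, rt, neg_sub]
    · intro i hi j hj hij
      rw [Set.disjoint_left]
      intro u hu hu'
      have := h.root_unique hk hf (by have := hi.1; simp only [rt]; omega)
        (by have := hj.1; simp only [rt]; omega) hu hu'
      simp only [rt] at this
      omega
    · exact h.exists_root hp hk hu
    · intro i hi u
      rw [h.child]
      obtain ⟨j, rfl⟩ : ∃ j : ℕ, i = j + 1 := ⟨(i - 1).toNat, by have := hi.1; omega⟩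
      have h2 := hi.2
      constructor
      · rintro (⟨v, -, -, h1⟩ | ⟨j', r, hj, hr, hrk, rfl, h1⟩)
        · simp only [rt] at h1
          omega
        · simp only [rt] at h1
          obtain rfl : j = j' := by omega
          push_cast
          constructor <;> ring_nf <;> omega
      · rintro ⟨h3, h4⟩
        ring_nf at h3 h4
        refine Or.inr ⟨j, (u - j * k - 1).toNat, by omega, by omega, by omega, ?_, by simp [rt]⟩
        push_cast
        omega
    · rintro ⟨m, hm⟩
      obtain ⟨w, rfl⟩ : ∃ w, m = w + 1 := ⟨m - 1, by have := (Finset.mem_Icc.1 hm).1; omega⟩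
      rw [h.child]
      have := Finset.mem_Icc.1 hm
      exact Or.inl ⟨w, by omega, ballVertex_succ k w, by rw [d.toFun_eq hm]⟩

/-! ### Codes of distributions -/

/-- The colour `r` of the urn `x_n`, `n = ik + r + 1`; it is `0` for `n = 0` and for the vertices
that belong to balls. -/
def urnColour (k n : ℕ) : ℕ := (n - 1) % k

theorem urnColour_zero (k : ℕ) : urnColour k 0 = 0 := by simp [urnColour]

theorem urnColour_add {k i r : ℕ} (hr : r < k) : urnColour k (i * k + r + 1) = r := by
  simp [urnColour, Nat.mod_eq_of_lt hr]

theorem urnColour_ball (k u : ℕ) : urnColour k (u * k + 1) = 0 := by simp [urnColour]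

theorem urn_cases (k n : ℕ) : n = 0 ∨ (∃ u, n = u * k + 1) ∨ urnColour k n ≠ 0 := by
  by_cases h : urnColour k n = 0
  · rcases n with - | n
    · exact Or.inl rfl
    · refine Or.inr (Or.inl ⟨n / k, ?_⟩)
      have := Nat.div_add_mod' n k
      rw [urnColour, Nat.add_sub_cancel] at h
      omega
  · exact Or.inr (Or.inr h)

theorem ball_injective {k u w : ℕ} (hk : 0 < k) (h : u * k + 1 = w * k + 1) : u = w :=
  Nat.eq_of_mul_eq_mul_right hk (by omega)

theorem lt_of_ball_le {k u v : ℕ} (h : u * k + 1 ≤ v * k) : u < v :=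
  lt_of_mul_lt_mul_right (a := k) (by omega) (Nat.zero_le _)

theorem ball_le_of_lt {k u v : ℕ} (hk : 0 < k) (h : u < v) : u * k + 1 ≤ v * k := by
  have := Nat.mul_le_mul_right k (Nat.succ_le_of_lt h)
  rw [Nat.succ_mul] at this
  omega

/-- Triples as functions on `ℕ`: if `v + 1` is joined to `i > 0` by an edge of colour `r`, then
`g v = (i - 1) k + r + 1`; if it is joined to `0`, then `g v` is the parent of the vertex `v k + 1`
in `S_0`. -/
structure IsCode (p k : ℕ) (g : ℕ → ℕ) : Prop where
  le : ∀ v < p, g v ≤ v * k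
  inj : ∀ v < p, ∀ w < p, ∀ u, g v = u * k + 1 → g w = u * k + 1 → v = w
  closed : ∀ v < p, ∀ u, g v = u * k + 1 → urnColour k (g u) = 0
  zero : ∀ v, p ≤ v → g v = 0

/-- The code of the triple assigned to the distribution `f`. -/
def code (k : ℕ) (f : ℕ → ℕ) (v : ℕ) : ℕ :=
  -- The first condition serves termination; for an urn function the other two imply it.
  if h : (f v - 1) / k < v ∧ f v ≠ 0 ∧ urnColour k (f v) = 0 then
    if urnColour k (code k f ((f v - 1) / k)) = 0 then f v else code k f ((f v - 1) / k)
  else f v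
termination_by v
decreasing_by all_goals exact h.1

theorem code_of_zero {k v : ℕ} {f : ℕ → ℕ} (h : f v = 0) : code k f v = 0 := by
  rw [code, dif_neg (by simp [h]), h]

theorem code_of_colour {k v : ℕ} {f : ℕ → ℕ} (h : urnColour k (f v) ≠ 0) :
    code k f v = f v := by
  rw [code, dif_neg (by simp [h])]

theorem code_of_ball {k v u : ℕ} {f : ℕ → ℕ} (hk : 0 < k) (huv : u < v) (h : f v = u * k + 1) :
    code k f v = if urnColour k (code k f u) = 0 then u * k + 1 else code k f u := by
  have h1 : (f v - 1) / k = u := by simp [h, hk]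
  rw [code, dif_pos ⟨by omega, by omega, by rw [h, urnColour_ball]⟩, h1, h]

section UrnFun

variable {p k : ℕ} {f : ℕ → ℕ}

theorem IsUrnFun.lt (hf : IsUrnFun p k f) {v u : ℕ} (hv : v < p) (h : f v = u * k + 1) : u < v :=
  lt_of_ball_le (h ▸ hf.le v hv)

/-- Colour `0` means that the upward chain ends in `x_0`, and then the code keeps the urn itself. -/
theorem IsUrnFun.code_colour_zero (hk : 0 < k) (hf : IsUrnFun p k f) {v : ℕ} (hv : v < p)
    (h : urnColour k (code k f v) = 0) : f v = code k f v := by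
  rcases urn_cases k (f v) with h1 | ⟨u, h1⟩ | h1
  · rw [code_of_zero h1, h1]
  · rw [code_of_ball hk (hf.lt hv h1) h1] at h ⊢
    split_ifs at h ⊢ with h2
    · exact h1
    · exact absurd h h2
  · rw [code_of_colour h1]

theorem IsUrnFun.code_colour_ne (hk : 0 < k) (hf : IsUrnFun p k f) {v : ℕ} (hv : v < p)
    (h : urnColour k (code k f v) ≠ 0) :
    f v = code k f v ∨ ∃ u < v, f v = u * k + 1 ∧ code k f u = code k f v := by
  rcases urn_cases k (f v) with h1 | ⟨u, h1⟩ | h1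
  · rw [code_of_zero h1] at h
    exact absurd (urnColour_zero k) h
  · refine Or.inr ⟨u, hf.lt hv h1, h1, ?_⟩
    rw [code_of_ball hk (hf.lt hv h1) h1] at h ⊢
    split_ifs at h ⊢ with h2
    · exact absurd (urnColour_ball k u) h
    · rfl
  · rw [code_of_colour h1]
    exact Or.inl rfl

theorem IsUrnFun.code_eq_zero_iff (hk : 0 < k) (hf : IsUrnFun p k f) {v : ℕ} (hv : v < p) :
    code k f v = 0 ↔ f v = 0 := by
  refine ⟨fun h => ?_, code_of_zero⟩
  rw [hf.code_colour_zero hk hv (by rw [h, urnColour_zero]), h]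

/-- Moving up a chain only lowers the bound `v * k`, and injectivity is the capacity condition. For
closure, a ball above `v` with a coloured end would have passed that end on to `v`. -/
theorem IsUrnFun.isCode (hk : 0 < k) (hf : IsUrnFun p k f) : IsCode p k (code k f) where
  le v := by
    induction v using Nat.strong_induction_on with
    | _ v ih =>
      intro hv
      by_cases h : urnColour k (code k f v) = 0
      · rw [← hf.code_colour_zero hk hv h]
        exact hf.le v hv
      · rcases hf.code_colour_ne hk hv h with h1 | ⟨u, hu, -, h1⟩
        · rw [← h1]
          exact hf.le v hv
        · rw [← h1]
          exact (ih u hu (hu.trans hv)).trans (Nat.mul_le_mul_right k hu.le)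
  inj v hv w hw u h h' := by
    have h1 := hf.code_colour_zero hk hv (by rw [h, urnColour_ball])
    have h2 := hf.code_colour_zero hk hw (by rw [h', urnColour_ball])
    exact hf.inj v hv w hw (by omega) (by omega)
  closed v hv u h := by
    have h1 := hf.code_colour_zero hk hv (by rw [h, urnColour_ball])
    have h3 := code_of_ball hk (hf.lt hv (h1.trans h)) (h1.trans h)
    by_contra h2
    rw [if_neg h2, h] at h3
    exact h2 (by rw [← h3, urnColour_ball])
  zero v hv := code_of_zero (hf.zero v hv)

/-- Strong induction on `v`. If the end is coloured, let `S` be the earlier balls with the same end.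
Every urn function with this code maps `S ∪ {v}` bijectively onto `A`, the end together with the
vertices of `S`; agreement on `S` leaves one value for `v`. -/
theorem code_injOn (hk : 0 < k) {f f' : ℕ → ℕ} (hf : IsUrnFun p k f) (hf' : IsUrnFun p k f')
    (h : code k f = code k f') : f = f' := by
  ext v
  rcases le_or_gt p v with hv | hv
  · rw [hf.zero v hv, hf'.zero v hv]
  induction v using Nat.strong_induction_on with
  | _ v ih =>
  by_cases hc : urnColour k (code k f v) = 0
  · rw [hf.code_colour_zero hk hv hc, hf'.code_colour_zero hk hv (h ▸ hc), h]
  have hb0 : code k f v ≠ 0 := fun e => hc (by rw [e, urnColour_zero])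
  set S := (Finset.range v).filter fun u => code k f u = code k f v with hS
  set A := insert (code k f v) (S.image fun u => u * k + 1) with hA
  have hA0 : ∀ n ∈ A, n ≠ 0 := by
    intro n hn
    rw [hA, Finset.mem_insert, Finset.mem_image] at hn
    rcases hn with rfl | ⟨u, -, rfl⟩
    · exact hb0
    · omega
  have hvS : v ∉ S := by simp [hS]
  have hcard : A.card ≤ (insert v S).card := by
    rw [Finset.card_insert_of_notMem hvS]
    exact (Finset.card_insert_le _ _).trans (Nat.add_le_add_right Finset.card_image_le 1)
  have hlt : ∀ w ∈ insert v S, w < p ∧ w ≤ v ∧ code k f w = code k f v := by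
    intro w hw
    rw [Finset.mem_insert, hS, Finset.mem_filter, Finset.mem_range] at hw
    rcases hw with rfl | ⟨h1, h2⟩
    · exact ⟨hv, le_rfl, rfl⟩
    · exact ⟨h1.trans hv, h1.le, h2⟩
  have key : ∀ f₁, IsUrnFun p k f₁ → code k f₁ = code k f → (insert v S).image f₁ = A := by
    intro f₁ hf₁ h₁
    have hmaps : ∀ w ∈ insert v S, f₁ w ∈ A := by
      intro w hw
      obtain ⟨hwp, hwv, hwc⟩ := hlt w hw
      rw [← h₁] at hwc hc
      rcases hf₁.code_colour_ne hk hwp (hwc ▸ hc) with h2 | ⟨u, hu, h2, h3⟩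
      · rw [h2, hwc, h₁]
        exact Finset.mem_insert_self _ _
      · rw [h2]
        refine Finset.mem_insert_of_mem (Finset.mem_image_of_mem _ ?_)
        rw [hS, Finset.mem_filter, Finset.mem_range, ← h₁]
        exact ⟨hu.trans_le hwv, h3.trans hwc⟩
    refine Finset.eq_of_subset_of_card_le (fun n hn => ?_) ?_
    · obtain ⟨w, hw, rfl⟩ := Finset.mem_image.1 hn
      exact hmaps w hw
    · rw [Finset.card_image_of_injOn]
      · exact hcard
      · intro w hw w' hw' e
        exact hf₁.inj w (hlt w hw).1 w' (hlt w' hw').1 (hA0 _ (hmaps w hw)) e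
  have hm : f v ∈ A := key f hf rfl ▸ Finset.mem_image_of_mem f (Finset.mem_insert_self v S)
  -- So `f v` is a value of `f'`. If `f'` takes it at some `w ∈ S`, then `f w = f v` by induction,
  -- against the capacity condition.
  rw [← key f' hf' h.symm] at hm
  obtain ⟨w, hw, hwv⟩ := Finset.mem_image.1 hm
  rw [Finset.mem_insert] at hw
  rcases hw with rfl | hw
  · exact hwv.symm
  · have hwlt : w < v := by
      rw [hS, Finset.mem_filter, Finset.mem_range] at hw
      exact hw.1
    rw [← ih w hwlt (hwlt.trans hv)] at hwv
    have h0 : f v ≠ 0 := fun e => hb0 (code_of_zero e)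
    exact absurd (hf.inj v hv w (hwlt.trans hv) h0 hwv.symm) hwlt.ne'

end UrnFun

/-- The alternatives in `hex` rebuild the chains: a value of colour `0` is kept, the least ball of a
coloured class goes into the urn `g v`, and any other into the vertex of its predecessor in the
class. -/
theorem IsCode.exists_urnFun {p k : ℕ} {g : ℕ → ℕ} (hk : 0 < k) (hg : IsCode p k g) :
    ∃ f, IsUrnFun p k f ∧ code k f = g := by
  have hex : ∀ v, ∃ n, (urnColour k (g v) = 0 ∧ n = g v) ∨
      (urnColour k (g v) ≠ 0 ∧ n = g v ∧ ∀ u < v, g u ≠ g v) ∨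
      (urnColour k (g v) ≠ 0 ∧ ∃ u < v, n = u * k + 1 ∧ g u = g v ∧
        ∀ u' < v, g u' = g v → u' ≤ u) := by
    intro v
    by_cases hc : urnColour k (g v) = 0
    · exact ⟨_, Or.inl ⟨hc, rfl⟩⟩
    by_cases hS : ∃ u < v, g u = g v
    · obtain ⟨u, hu, hmax⟩ := Finset.exists_max_image
        ((Finset.range v).filter fun u => g u = g v) id (by
          obtain ⟨u, h⟩ := hS
          exact ⟨u, by simpa using h⟩)
      simp only [Finset.mem_filter, Finset.mem_range] at hu hmax
      exact ⟨_, Or.inr (Or.inr ⟨hc, u, hu.1, rfl, hu.2, fun u' h h' => hmax u' ⟨h, h'⟩⟩)⟩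
    · push Not at hS
      exact ⟨_, Or.inr (Or.inl ⟨hc, rfl, hS⟩)⟩
  choose f hf using hex
  have hU : IsUrnFun p k f := by
    refine ⟨fun v hv => ?_, fun v hv w hw h0 he => ?_, fun v hv => ?_⟩
    · rcases hf v with ⟨-, h⟩ | ⟨-, h, -⟩ | ⟨-, u, hu, h, -⟩
      · exact h ▸ hg.le v hv
      · exact h ▸ hg.le v hv
      · exact h ▸ ball_le_of_lt hk hu
    · rcases hf v with ⟨h1, h2⟩ | ⟨h1, h2, h3⟩ | ⟨h1, u, hu, h2, h3, h4⟩ <;>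
      rcases hf w with ⟨h1', h2'⟩ | ⟨h1', h2', h3'⟩ | ⟨h1', u', hu', h2', h3', h4'⟩
      · have hgg : g v = g w := by omega
        rcases urn_cases k (g v) with h | ⟨u, h⟩ | h
        · omega
        · exact hg.inj v hv w hw u h (hgg ▸ h)
        · exact absurd h1 h
      · exact absurd h1 (by rwa [show g v = g w by omega])
      -- Closure at `v` puts `u'` into `S_0`, while `u'` belongs to a coloured class.
      · exact absurd (hg.closed v hv u' (by omega)) (by rwa [h3'])
      · exact absurd h1' (by rwa [show g w = g v by omega])
      · rcases lt_trichotomy v w with h | h | h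
        · exact absurd (by omega) (h3' v h)
        · exact h
        · exact absurd (by omega) (h3 w h)
      · rw [show g v = u' * k + 1 by omega, urnColour_ball] at h1
        exact absurd rfl h1
      · exact absurd (hg.closed w hw u (by omega)) (by rwa [h3])
      · rw [show g w = u * k + 1 by omega, urnColour_ball] at h1'
        exact absurd rfl h1'
      · obtain rfl : u = u' := ball_injective hk (by omega)
        -- `u` precedes both in one class, so the smaller of two distinct balls would come between
        -- `u` and the larger.
        rcases lt_trichotomy v w with h | h | h
        · have := h4' v h (by omega)
          omega
        · exact h
        · have := h4 w h (by omega)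
          omega
    · rcases hf v with ⟨h1, h2⟩ | ⟨h1, -⟩ | ⟨h1, -⟩
      · rw [h2, hg.zero v hv]
      · exact absurd (by rw [hg.zero v hv, urnColour_zero]) h1
      · exact absurd (by rw [hg.zero v hv, urnColour_zero]) h1
  refine ⟨f, hU, ?_⟩
  ext v
  rcases le_or_gt p v with hv | hv
  · rw [hg.zero v hv, code_of_zero (hU.zero v hv)]
  induction v using Nat.strong_induction_on with
  | _ v ih =>
  rcases hf v with ⟨h1, h2⟩ | ⟨h1, h2, -⟩ | ⟨h1, u, hu, h2, h3, -⟩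
  · rcases urn_cases k (g v) with h | ⟨u, h⟩ | h
    · rw [code_of_zero (h2.trans h), h]
    · have hu := hU.lt hv (h2.trans h)
      rw [code_of_ball hk hu (h2.trans h), ih u hu (hu.trans hv), if_pos (hg.closed v hv u h), h]
    · exact absurd h1 h
  · rw [code_of_colour (by rwa [h2]), h2]
  · rw [code_of_ball hk hu h2, ih u hu (hu.trans hv), if_neg (by rwa [h3]), h3]

/-! ### Codes of triples -/

/-- The vertex `i` that is joined to `v + 1` in `T` if the code has the value `n` at `v`. -/
def urnParent (k n : ℕ) : ℕ := if urnColour k n = 0 then 0 else (n - 1) / k + 1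

theorem urnParent_eq_zero_iff {k n : ℕ} : urnParent k n = 0 ↔ urnColour k n = 0 := by
  unfold urnParent
  split_ifs with h <;> simp [h]

theorem urnParent_add {k i r : ℕ} (h0 : r ≠ 0) (hr : r < k) :
    urnParent k (i * k + r + 1) = i + 1 := by
  rw [urnParent, urnColour_add hr, if_neg h0, Nat.add_sub_cancel, add_comm (i * k),
    Nat.add_mul_div_right _ _ (by omega), Nat.div_eq_of_lt hr, zero_add]

theorem exists_eq_of_colour {k n : ℕ} (hk : 0 < k) (h : urnColour k n ≠ 0) :
    ∃ i r, n = i * k + r + 1 ∧ r ≠ 0 ∧ r < k := by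
  refine ⟨(n - 1) / k, (n - 1) % k, ?_, h, Nat.mod_lt _ hk⟩
  have h1 : n ≠ 0 := by
    rintro rfl
    exact h (urnColour_zero k)
  have := Nat.div_add_mod' (n - 1) k
  omega

theorem urnParent_le {k n v : ℕ} (hk : 0 < k) (h : n ≤ v * k) : urnParent k n ≤ v := by
  by_cases hc : urnColour k n = 0
  · rw [urnParent_eq_zero_iff.2 hc]
    exact Nat.zero_le v
  · obtain ⟨i, r, rfl, h0, hr⟩ := exists_eq_of_colour hk hc
    rw [urnParent_add h0 hr]
    exact lt_of_mul_lt_mul_right (a := k) (by omega) (Nat.zero_le _)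

theorem eq_of_parent_colour {k n m : ℕ} (hk : 0 < k) (hc : urnColour k n ≠ 0)
    (h1 : urnParent k n = urnParent k m) (h2 : urnColour k n = urnColour k m) : n = m := by
  obtain ⟨i, r, rfl, h0, hr⟩ := exists_eq_of_colour hk hc
  obtain ⟨j, s, rfl, h0', hs⟩ := exists_eq_of_colour hk (h2 ▸ hc)
  rw [urnParent_add h0 hr, urnParent_add h0' hs] at h1
  rw [urnColour_add hr, urnColour_add hs] at h2
  obtain rfl : i = j := by omega
  rw [h2]

/-- The triple `t` is described by the code `g`. -/
structure IsCodeOf (p k : ℕ) (g : ℕ → ℕ) (t : Triple) : Prop where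
  tree_verts : t.T.verts = Set.Icc (0 : ℤ) p
  tree_child : ∀ a b, IsChild t.T a b ↔
    ∃ v < p, b = ((v + 1 : ℕ) : ℤ) ∧ a = (urnParent k (g v) : ℤ)
  colour : ∀ e r, t.colour e = some r ↔
    ∃ v < p, e = s((urnParent k (g v) : ℤ), ((v + 1 : ℕ) : ℤ)) ∧ r = urnColour k (g v)
  star_verts : ∀ u, u ∈ t.S.verts ↔
    u = 0 ∨ ∃ v < p, u = ((v * k + 1 : ℕ) : ℤ) ∧ urnColour k (g v) = 0
  star_child : ∀ a b, IsChild t.S a b ↔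
    ∃ v < p, b = ((v * k + 1 : ℕ) : ℤ) ∧ urnColour k (g v) = 0 ∧ a = (g v : ℤ)

section CodeOf

variable {p k : ℕ} {g : ℕ → ℕ} {t : Triple}

theorem IsCodeOf.triple_unique {t' : Triple} (h : IsCodeOf p k g t) (h' : IsCodeOf p k g t') :
    t = t' := by
  refine Triple.ext (ext_of_isChild (h.tree_verts.trans h'.tree_verts.symm) fun a b =>
    (h.tree_child a b).trans (h'.tree_child a b).symm) ?_ (ext_of_isChild ?_ fun a b =>
    (h.star_child a b).trans (h'.star_child a b).symm)
  · ext e r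
    exact (h.colour e r).trans (h'.colour e r).symm
  · ext u
    exact (h.star_verts u).trans (h'.star_verts u).symm

/-- The edge above `v + 1` and its colour determine a coloured value; a value of colour `0` is the
parent of `vk+1` in `S_0`. -/
theorem IsCodeOf.code_unique {g' : ℕ → ℕ} (hk : 0 < k) (hg : IsCode p k g) (hg' : IsCode p k g')
    (h : IsCodeOf p k g t) (h' : IsCodeOf p k g' t) : g = g' := by
  ext v
  rcases le_or_gt p v with hv | hv
  · rw [hg.zero v hv, hg'.zero v hv]
  have h1 : urnParent k (g v) = urnParent k (g' v) := by
    obtain ⟨w, -, hw, hp⟩ := (h'.tree_child _ _).1 ((h.tree_child _ _).2 ⟨v, hv, rfl, rfl⟩)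
    obtain rfl : v = w := by omega
    exact_mod_cast hp
  have h2 : urnColour k (g v) = urnColour k (g' v) := by
    obtain ⟨w, hw, he, hc⟩ := (h'.colour _ _).1 ((h.colour _ _).2 ⟨v, hv, rfl, rfl⟩)
    have h3 := urnParent_le hk (hg.le v hv)
    have h4 := urnParent_le hk (hg'.le w hw)
    -- The two edges cannot match with their ends interchanged, because parents are smaller.
    rcases Sym2.eq_iff.1 he with ⟨-, h5⟩ | ⟨h5, h6⟩
    · obtain rfl : v = w := by omega
      exact hc
    · omega
  by_cases hc : urnColour k (g v) = 0
  · obtain ⟨w, -, hw, -, hp⟩ :=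
      (h'.star_child _ _).1 ((h.star_child _ _).2 ⟨v, hv, rfl, hc, rfl⟩)
    obtain rfl : v = w := ball_injective hk (by omega)
    exact_mod_cast hp
  · exact eq_of_parent_colour hk hc h1 h2

theorem mem_edgeSet_iff_isChild {G : Gr} {e : Sym2 ℤ} :
    e ∈ G.edgeSet ↔ ∃ a b, e = s(a, b) ∧ IsChild G a b := by
  constructor
  · induction e with
    | h a b =>
      intro h
      rcases adj_iff_isChild.1 (Subgraph.mem_edgeSet.1 h) with h | h
      · exact ⟨a, b, rfl, h⟩
      · exact ⟨b, a, Sym2.eq_swap, h⟩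
  · rintro ⟨a, b, rfl, h⟩
    exact h.1

theorem IsCodeOf.isTriple (hk : 0 < k) (hg : IsCode p k g) (h : IsCodeOf p k g t) :
    IsTriple p k t where
  tree_verts := h.tree_verts
  tree := by
    rw [isIncreasingTree_iff, h.tree_verts]
    refine ⟨Set.finite_Icc _ _, ⟨⟨le_rfl, by omega⟩, fun a ha => ha.1⟩, fun v hv hv0 => ?_⟩
    obtain ⟨w, rfl⟩ : ∃ w : ℕ, v = ((w + 1 : ℕ) : ℤ) :=
      ⟨(v - 1).toNat, by have := hv.1; omega⟩
    have hw : w < p := by have := hv.2; omega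
    refine ⟨_, (h.tree_child _ _).2 ⟨w, hw, rfl, rfl⟩, fun u hu => ?_⟩
    obtain ⟨w', -, hw', rfl⟩ := (h.tree_child _ _).1 hu
    obtain rfl : w = w' := by omega
    rfl
  colour_none e he := by
    rw [Option.eq_none_iff_forall_ne_some]
    intro r hr
    obtain ⟨v, hv, rfl, -⟩ := (h.colour _ _).1 hr
    exact he (mem_edgeSet_iff_isChild.2 ⟨_, _, rfl, (h.tree_child _ _).2 ⟨v, hv, rfl, rfl⟩⟩)
  colour_root e he h0 := by
    obtain ⟨a, b, rfl, hc⟩ := mem_edgeSet_iff_isChild.1 he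
    obtain ⟨v, hv, rfl, rfl⟩ := (h.tree_child _ _).1 hc
    refine (h.colour _ _).2 ⟨v, hv, rfl, ?_⟩
    rw [Sym2.mem_iff] at h0
    exact (urnParent_eq_zero_iff.1 (by omega)).symm
  colour_other e he h0 := by
    obtain ⟨a, b, rfl, hc⟩ := mem_edgeSet_iff_isChild.1 he
    obtain ⟨v, hv, rfl, rfl⟩ := (h.tree_child _ _).1 hc
    have h1 : urnColour k (g v) ≠ 0 := by
      intro h1
      exact h0 (Sym2.mem_iff.2 (Or.inl (by rw [urnParent_eq_zero_iff.2 h1]; rfl)))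
    have h2 : urnColour k (g v) < k := Nat.mod_lt _ hk
    exact ⟨_, by omega, by omega, (h.colour _ _).2 ⟨v, hv, rfl, rfl⟩⟩
  star_verts := by
    ext u
    rw [h.star_verts, Set.mem_insert_iff]
    refine or_congr_right ⟨?_, ?_⟩
    · rintro ⟨v, hv, rfl, hc⟩
      refine ⟨_, (h.tree_child _ _).2 ⟨v, hv, rfl, ?_⟩, ballVertex_succ k v⟩
      rw [urnParent_eq_zero_iff.2 hc]
      rfl
    · rintro ⟨w, hw, rfl⟩
      obtain ⟨v, hv, rfl, h0⟩ := (h.tree_child _ _).1 hw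
      exact ⟨v, hv, ballVertex_succ k v, urnParent_eq_zero_iff.1 (by omega)⟩
  star := by
    rw [isStarlike_iff]
    refine ⟨⟨?_, ⟨?_, ?_⟩, ?_⟩, ?_⟩
    · refine ((Finset.range p).finite_toSet.image fun v : ℕ => ((v * k + 1 : ℕ) : ℤ)).insert 0
        |>.subset fun u hu => ?_
      rcases (h.star_verts u).1 hu with rfl | ⟨v, hv, rfl, -⟩
      · exact Set.mem_insert _ _
      · exact Set.mem_insert_of_mem _ ⟨v, by simpa using hv, rfl⟩
    · exact (h.star_verts 0).2 (Or.inl rfl)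
    · intro u hu
      rcases (h.star_verts u).1 hu with rfl | ⟨v, hv, rfl, -⟩ <;> omega
    · intro u hu hu0
      rcases (h.star_verts u).1 hu with rfl | ⟨v, hv, rfl, hc⟩
      · exact absurd rfl hu0
      · refine ⟨_, (h.star_child _ _).2 ⟨v, hv, rfl, hc, rfl⟩, fun a ha => ?_⟩
        obtain ⟨w, -, hw, -, rfl⟩ := (h.star_child _ _).1 ha
        obtain rfl : v = w := ball_injective hk (by omega)
        rfl
    · intro u a b hu ha hb
      obtain ⟨v, hv, rfl, hc, rfl⟩ := (h.star_child _ _).1 ha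
      obtain ⟨w, hw, rfl, -, hvw⟩ := (h.star_child _ _).1 hb
      rcases urn_cases k (g v) with h1 | ⟨x, h1⟩ | h1
      · exact absurd (by rw [h1]; rfl) hu
      · rw [hg.inj v hv w hw x h1 (by omega)]
      · exact absurd hc h1

/-- Each value is read off the edge above `v + 1`, or off `S_0` if that edge is at the root.
Starlikeness gives injectivity on ball vertices; closure holds because nonzero vertices of `S_0`
come from children of `0` in `T`. -/
theorem IsTriple.exists_code (hk : 0 < k) (h : IsTriple p k t) :
    ∃ g, IsCode p k g ∧ IsCodeOf p k g t := by
  obtain ⟨-, -, hT⟩ := isIncreasingTree_iff.1 h.tree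
  obtain ⟨⟨-, -, hS⟩, hstar⟩ := isStarlike_iff.1 h.star
  rw [h.tree_verts] at hT
  have hS0 : ∀ u ∈ t.S.verts, 0 ≤ u := fun u hu => h.star.isIncreasingTree.root.2 hu
  have hchild : ∀ {v : ℕ}, IsChild t.T 0 ((v + 1 : ℕ) : ℤ) →
      ((v * k + 1 : ℕ) : ℤ) ∈ t.S.verts := by
    intro v hv
    rw [h.star_verts]
    exact Or.inr ⟨_, hv, ballVertex_succ k v⟩
  have hSv : ∀ u ∈ t.S.verts, u = 0 ∨ ∃ v < p, u = ((v * k + 1 : ℕ) : ℤ) ∧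
      IsChild t.T 0 ((v + 1 : ℕ) : ℤ) := by
    intro u hu
    rw [h.star_verts] at hu
    rcases hu with hu | ⟨w, hw, rfl⟩
    · exact Or.inl hu
    · have h1 := hw.2
      have h2 := hw.mem_right
      rw [h.tree_verts] at h2
      obtain ⟨v, rfl⟩ : ∃ v : ℕ, w = ((v + 1 : ℕ) : ℤ) := ⟨(w - 1).toNat, by omega⟩
      exact Or.inr ⟨v, by have := h2.2; omega, ballVertex_succ k v, hw⟩
  have hT' : ∀ v < p, ∃! u, IsChild t.T u ((v + 1 : ℕ) : ℤ) := fun v hv =>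
    hT _ ⟨by omega, by omega⟩ (by omega)
  have hex : ∀ v < p, ∃ n ≤ v * k, IsChild t.T (urnParent k n : ℤ) ((v + 1 : ℕ) : ℤ) ∧
      t.colour s((urnParent k n : ℤ), ((v + 1 : ℕ) : ℤ)) = some (urnColour k n) ∧
      (urnColour k n = 0 → IsChild t.S (n : ℤ) ((v * k + 1 : ℕ) : ℤ)) := by
    intro v hv
    obtain ⟨i, hi, -⟩ := hT' v hv
    have hi0 := hi.mem_left
    rw [h.tree_verts] at hi0
    have he : s(i, ((v + 1 : ℕ) : ℤ)) ∈ t.T.edgeSet :=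
      mem_edgeSet_iff_isChild.2 ⟨_, _, rfl, hi⟩
    by_cases hiz : i = 0
    · subst hiz
      obtain ⟨u, hu, -⟩ := hS _ (hchild hi) (by omega)
      have hu0 := hS0 u hu.mem_left
      lift u to ℕ using hu0
      have hc : urnColour k u = 0 := by
        rcases hSv _ hu.mem_left with h1 | ⟨w, -, h1, -⟩
        · rw [show u = 0 by omega, urnColour_zero]
        · rw [show u = w * k + 1 by omega, urnColour_ball]
      refine ⟨u, by have := hu.2; omega, ?_, ?_, fun _ => hu⟩
      · rw [urnParent_eq_zero_iff.2 hc]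
        exact hi
      · rw [urnParent_eq_zero_iff.2 hc, hc]
        exact h.colour_root _ he (Sym2.mem_mk_left _ _)
    · obtain ⟨r, hr1, hrk, hr⟩ := h.colour_other _ he (by rw [Sym2.mem_iff]; omega)
      obtain ⟨j, rfl⟩ : ∃ j : ℕ, i = ((j + 1 : ℕ) : ℤ) :=
        ⟨(i - 1).toNat, by have := hi0.1; omega⟩
      -- The parent `j + 1` is at most `v`, whence `jk+r+1 ≤ (j+1)k ≤ vk`.
      have hjv : (j + 1) * k ≤ v * k := Nat.mul_le_mul_right k (by have := hi.2; omega)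
      rw [add_mul] at hjv
      refine ⟨j * k + r + 1, by omega, ?_, ?_, fun h0 => ?_⟩
      · rwa [urnParent_add (by omega) (by omega)]
      · rwa [urnParent_add (by omega) (by omega), urnColour_add (by omega)]
      · rw [urnColour_add (by omega)] at h0
        omega
  choose! n hle hnT hnc hnS using hex
  obtain ⟨g, hg, hg0⟩ : ∃ g : ℕ → ℕ, (∀ v < p, g v = n v) ∧ ∀ v, p ≤ v → g v = 0 :=
    ⟨fun v => if v < p then n v else 0, fun v hv => if_pos hv, fun v hv => if_neg hv.not_gt⟩
  replace hle : ∀ v < p, g v ≤ v * k := fun v hv => hg v hv ▸ hle v hv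
  replace hnT : ∀ v < p, IsChild t.T (urnParent k (g v) : ℤ) ((v + 1 : ℕ) : ℤ) :=
    fun v hv => hg v hv ▸ hnT v hv
  replace hnc : ∀ v < p, t.colour s((urnParent k (g v) : ℤ), ((v + 1 : ℕ) : ℤ)) =
    some (urnColour k (g v)) := fun v hv => hg v hv ▸ hnc v hv
  replace hnS : ∀ v < p, urnColour k (g v) = 0 →
    IsChild t.S (g v : ℤ) ((v * k + 1 : ℕ) : ℤ) := fun v hv => hg v hv ▸ hnS v hv
  have hzero : ∀ v < p, IsChild t.T 0 ((v + 1 : ℕ) : ℤ) → urnColour k (g v) = 0 := by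
    intro v hv hc
    have := (hT' v hv).unique (hnT v hv) hc
    exact urnParent_eq_zero_iff.1 (by omega)
  have hzero' : ∀ v < p, urnColour k (g v) = 0 → IsChild t.T 0 ((v + 1 : ℕ) : ℤ) := by
    intro v hv hc
    have := hnT v hv
    rwa [urnParent_eq_zero_iff.2 hc] at this
  have htree : ∀ a b, IsChild t.T a b ↔
      ∃ v < p, b = ((v + 1 : ℕ) : ℤ) ∧ a = (urnParent k (g v) : ℤ) := by
    intro a b
    constructor
    · intro hc
      have h1 := hc.mem_left
      have h2 := hc.mem_right
      have h3 := hc.2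
      rw [h.tree_verts, Set.mem_Icc] at h1 h2
      obtain ⟨v, rfl⟩ : ∃ v : ℕ, b = ((v + 1 : ℕ) : ℤ) := ⟨(b - 1).toNat, by omega⟩
      have hv : v < p := by omega
      exact ⟨v, hv, rfl, (hT' v hv).unique hc (hnT v hv)⟩
    · rintro ⟨v, hv, rfl, rfl⟩
      exact hnT v hv
  refine ⟨g, ⟨hle, ?_, ?_, hg0⟩, h.tree_verts, htree, ?_, ?_, ?_⟩
  · intro v hv w hw u h1 h2
    have h3 := hnS v hv (by rw [h1, urnColour_ball])
    have h4 := hnS w hw (by rw [h2, urnColour_ball])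
    rw [h1] at h3
    rw [h2] at h4
    exact ball_injective hk (by exact_mod_cast hstar _ _ _ (by omega) h3 h4)
  · intro v hv u h1
    have h3 := (hnS v hv (by rw [h1, urnColour_ball])).mem_left
    rw [h1] at h3
    rcases hSv _ h3 with h4 | ⟨w, hw, h4, h5⟩
    · omega
    · obtain rfl : u = w := ball_injective hk (by omega)
      exact hzero u hw h5
  · intro e r
    constructor
    · intro hr
      have he : e ∈ t.T.edgeSet := by
        by_contra he
        rw [h.colour_none e he] at hr
        exact absurd hr (by simp)
      obtain ⟨a, b, rfl, hc⟩ := mem_edgeSet_iff_isChild.1 he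
      obtain ⟨v, hv, rfl, rfl⟩ := (htree _ _).1 hc
      refine ⟨v, hv, rfl, ?_⟩
      rw [hnc v hv] at hr
      exact (Option.some.inj hr).symm
    · rintro ⟨v, hv, rfl, rfl⟩
      exact hnc v hv
  · intro u
    constructor
    · intro hu
      rcases hSv u hu with hu | ⟨v, hv, rfl, hc⟩
      · exact Or.inl hu
      · exact Or.inr ⟨v, hv, rfl, hzero v hv hc⟩
    · rintro (rfl | ⟨v, hv, rfl, hc⟩)
      · exact h.star.isIncreasingTree.root.1
      · exact hchild (hzero' v hv hc)
  · intro a b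
    constructor
    · intro hc
      have ha := hS0 a hc.mem_left
      have hb := hc.2
      rcases hSv b hc.mem_right with h1 | ⟨v, hv, rfl, h1⟩
      · omega
      · have h2 := hzero v hv h1
        exact ⟨v, hv, rfl, h2, (hS _ hc.mem_right (by omega)).unique hc (hnS v hv h2)⟩
    · rintro ⟨v, hv, rfl, hc, rfl⟩
      exact hnS v hv hc

end CodeOf

/-! ### Ancestors as chains of children -/

theorem reflTransGen_isChild_le {F : Gr} {a b : ℤ} (h : ReflTransGen (IsChild F) a b) : a ≤ b := by
  induction h with
  | refl => exact le_rfl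
  | tail _ h ih => exact ih.trans h.2.le

theorem reflTransGen_isChild_reachable {F : Gr} {a b : ℤ} (h : ReflTransGen (IsChild F) a b) :
    F.spanningCoe.Reachable a b := by
  induction h with
  | refl => exact Reachable.refl _
  | tail _ h ih => exact ih.trans h.reachable

/-- Prepending a parent keeps a walk increasing, and increasing walks are paths; this supplies the
paths that `IsAncestor` demands. -/
theorem exists_increasing_walk {F : Gr} {a b w : ℤ} (h : ReflTransGen (IsChild F) a b)
    (R : F.spanningCoe.Walk b w) (hR : R.support.Pairwise (· < ·)) :
    ∃ P : F.spanningCoe.Walk a w, P.support.Pairwise (· < ·) ∧ R.support ⊆ P.support := by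
  induction h using ReflTransGen.head_induction_on with
  | refl => exact ⟨R, hR, List.Subset.refl _⟩
  | @head a c hac _ ih =>
    obtain ⟨P, hP, hRP⟩ := ih
    refine ⟨.cons (show F.spanningCoe.Adj a c from hac.1) P, ?_, ?_⟩
    · rw [Walk.support_cons, List.pairwise_cons]
      exact ⟨fun x hx => hac.2.trans_le (mem_support_bounds P hP x hx).1, hP⟩
    · rw [Walk.support_cons]
      exact List.subset_cons_of_subset _ hRP

theorem isAncestor_of_reflTransGen {F : Gr} {i u w : ℤ}
    (h : ReflTransGen (IsChild F) (rt i) u) (h' : ReflTransGen (IsChild F) u w) :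
    IsAncestor F i u w := by
  obtain ⟨Q, hQ, -⟩ := exists_increasing_walk h' (.nil : F.spanningCoe.Walk w w) (by simp)
  obtain ⟨P, hP, hQP⟩ := exists_increasing_walk h Q hQ
  exact ⟨P, (Walk.isPath_def P).2 (hP.imp ne_of_lt), hQP Q.start_mem_support⟩

theorem reflTransGen_of_mem_support {F : Gr} {a w : ℤ} (P : F.spanningCoe.Walk a w)
    (hP : P.support.Pairwise (· < ·)) : ∀ u ∈ P.support, ReflTransGen (IsChild F) u w := by
  induction P with
  | nil =>
    intro u hu
    rw [Walk.support_nil, List.mem_singleton] at hu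
    rw [hu]
  | @cons a b w e q ih =>
    rw [Walk.support_cons, List.pairwise_cons] at hP
    intro u hu
    rw [Walk.support_cons, List.mem_cons] at hu
    rcases hu with rfl | hu
    · exact ReflTransGen.head ⟨e, hP.1 b q.start_mem_support⟩ (ih hP.2 b q.start_mem_support)
    · exact ih hP.2 u hu

/-! ### The code of `Ξ(F)` -/

section Xi

variable {p k : ℕ} {f : ℕ → ℕ} {F : Gr}

theorem IsLocalForest.isChild_ball (h : IsLocalForest p k f F) {v : ℕ} (hv : v < p) :
    IsChild F (f v : ℤ) ((v * k + 1 : ℕ) : ℤ) :=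
  (h.child _ _).2 (Or.inl ⟨v, hv, rfl, rfl⟩)

theorem IsLocalForest.parent_ball (hk : 0 < k) (h : IsLocalForest p k f F) {v : ℕ} (hv : v < p)
    {a : ℤ} (ha : IsChild F a ((v * k + 1 : ℕ) : ℤ)) : a = f v :=
  h.lower_unique hk _ _ _ ha (h.isChild_ball hv)

/-- Vertices that do not belong to balls are children of the roots `r_i`. -/
theorem IsLocalForest.isChild_root (hk : 0 < k) (h : IsLocalForest p k f F) {n v : ℕ}
    (hv : v < p) (hn : n ≤ v * k) (hc : urnColour k n ≠ 0) :
    IsChild F (rt (urnParent k n)) (n : ℤ) := by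
  have h1 := urnParent_le hk hn
  obtain ⟨i, r, rfl, h0, hr⟩ := exists_eq_of_colour hk hc
  rw [urnParent_add h0 hr] at h1 ⊢
  exact (h.child _ _).2 (Or.inr ⟨i, r, by omega, by omega, hr, rfl, by simp [rt]⟩)

/-- Induction along the chain of balls: it ends at `0 = rt 0`, or at a coloured vertex whose parent
is the root symbol. -/
theorem IsLocalForest.reflTransGen_root (hk : 0 < k) (hf : IsUrnFun p k f)
    (h : IsLocalForest p k f F) {v : ℕ} (hv : v < p) :
    ReflTransGen (IsChild F) (rt (urnParent k (code k f v))) ((v * k + 1 : ℕ) : ℤ) := by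
  induction v using Nat.strong_induction_on with
  | _ v ih =>
  rcases urn_cases k (f v) with h1 | ⟨u, h1⟩ | h1
  · have h2 := h.isChild_ball hv
    rw [code_of_zero h1, urnParent_eq_zero_iff.2 (urnColour_zero k)]
    rw [h1] at h2
    exact .single h2
  · have hu := hf.lt hv h1
    have h2 := h.isChild_ball hv
    rw [h1] at h2
    have h3 := (ih u hu (hu.trans hv)).tail h2
    rw [code_of_ball hk hu h1]
    split_ifs with h4
    · rw [urnParent_eq_zero_iff.2 h4] at h3
      rwa [urnParent_eq_zero_iff.2 (urnColour_ball k u)]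
    · exact h3
  · rw [code_of_colour h1]
    exact (ReflTransGen.single (h.isChild_root hk hv (hf.le v hv) h1)).tail (h.isChild_ball hv)

theorem IsLocalForest.reflTransGen_code (hk : 0 < k) (hf : IsUrnFun p k f)
    (h : IsLocalForest p k f F) {v : ℕ} (hv : v < p) (hc : urnColour k (code k f v) ≠ 0) :
    ReflTransGen (IsChild F) (code k f v : ℤ) ((v * k + 1 : ℕ) : ℤ) := by
  induction v using Nat.strong_induction_on with
  | _ v ih =>
  have h2 := h.isChild_ball hv
  rcases hf.code_colour_ne hk hv hc with h1 | ⟨u, hu, h1, h3⟩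
  · rw [← h1]
    exact .single h2
  · rw [h1] at h2
    rw [← h3] at hc ⊢
    exact (ih u hu (hu.trans hv) hc).tail h2

theorem IsLocalForest.code_eq_of_reflTransGen (hk : 0 < k) (hf : IsUrnFun p k f)
    (h : IsLocalForest p k f F) {v n : ℕ} (hv : v < p) (hc : urnColour k n ≠ 0)
    (hn : ReflTransGen (IsChild F) (n : ℤ) ((v * k + 1 : ℕ) : ℤ)) : code k f v = n := by
  induction v using Nat.strong_induction_on with
  | _ v ih =>
  have hn0 : n ≠ 0 := by
    rintro rfl
    exact hc (urnColour_zero k)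
  rcases ReflTransGen.cases_tail hn with h1 | ⟨c, h1, h2⟩
  · rw [show n = v * k + 1 by omega, urnColour_ball] at hc
    exact absurd rfl hc
  · rw [h.parent_ball hk hv h2] at h1
    rcases urn_cases k (f v) with h3 | ⟨u, h3⟩ | h3
    · have := reflTransGen_isChild_le h1
      omega
    · have hu := hf.lt hv h3
      rw [h3] at h1
      rw [code_of_ball hk hu h3, ih u hu (hu.trans hv) h1, if_neg hc]
    · rw [code_of_colour h3]
      -- Only a root `≤ 0` lies above the coloured urn `f v`, so the positive `n` must be `f v`.
      rcases ReflTransGen.cases_tail h1 with h4 | ⟨c, h4, h5⟩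
      · exact_mod_cast h4
      · have h6 := h.lower_unique hk _ _ _ h5 (h.isChild_root hk hv (hf.le v hv) h3)
        have := reflTransGen_isChild_le h4
        simp only [rt] at h6
        omega

theorem IsLocalForest.root_eq (hk : 0 < k) (hf : IsUrnFun p k f)
    (h : IsLocalForest p k f F) {v : ℕ} (hv : v < p) {i : ℤ} (hi : 0 ≤ i)
    (hr : F.spanningCoe.Reachable (rt i) ((v * k + 1 : ℕ) : ℤ)) :
    i = urnParent k (code k f v) := by
  have := h.root_unique hk hf (by simp only [rt]; omega) (by simp only [rt]; omega) hr
    (reflTransGen_isChild_reachable (h.reflTransGen_root hk hf hv))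
  simp only [rt] at this
  omega

theorem IsLocalForest.omegaEdge_iff (hk : 0 < k) (hf : IsUrnFun p k f)
    (h : IsLocalForest p k f F) (i v : ℤ) : OmegaEdge p k F i v ↔
      ∃ w < p, v = ((w + 1 : ℕ) : ℤ) ∧ i = (urnParent k (code k f w) : ℤ) := by
  constructor
  · rintro ⟨hi, hv, hr⟩
    obtain ⟨w, rfl⟩ : ∃ w : ℕ, v = ((w + 1 : ℕ) : ℤ) :=
      ⟨(v - 1).toNat, by have := hv.1; omega⟩
    have hw : w < p := by have := hv.2; omega
    rw [ballVertex_succ, mem_comp] at hr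
    exact ⟨w, hw, rfl, h.root_eq hk hf hw hi.1 hr⟩
  · rintro ⟨w, hw, rfl, rfl⟩
    have := urnParent_le hk ((hf.isCode hk).le w hw)
    refine ⟨⟨by omega, by omega⟩, ⟨by omega, by omega⟩, ?_⟩
    rw [ballVertex_succ, mem_comp]
    exact reflTransGen_isChild_reachable (h.reflTransGen_root hk hf hw)

/-- The only coloured ancestor of a ball vertex is the end of its chain, which is the value that the
code stores. -/
theorem IsLocalForest.omegaColour_iff (hk : 0 < k) (hf : IsUrnFun p k f)
    (h : IsLocalForest p k f F) (i v : ℤ) (r : ℕ) : OmegaColour p k F i v r ↔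
      ∃ w < p, v = ((w + 1 : ℕ) : ℤ) ∧ i = (urnParent k (code k f w) : ℤ) ∧
        r = urnColour k (code k f w) := by
  rw [OmegaColour, h.omegaEdge_iff hk hf]
  constructor
  · rintro ⟨⟨w, hw, rfl, rfl⟩, h1⟩
    refine ⟨w, hw, rfl, rfl, ?_⟩
    rcases h1 with ⟨h1, rfl⟩ | ⟨h1, hr, hrk, P, hP, hmem⟩
    · exact (urnParent_eq_zero_iff.1 (by omega)).symm
    · obtain ⟨j, hj⟩ : ∃ j, urnParent k (code k f w) = j + 1 :=
        ⟨urnParent k (code k f w) - 1, by omega⟩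
      have h2 := reflTransGen_of_mem_support P
        (h.increasing hk hf (by simp only [rt]; omega) P hP) _ hmem
      rw [ballVertex_succ, hj, show (((j + 1 : ℕ) : ℤ) - 1) * k + r + 1 =
        ((j * k + r + 1 : ℕ) : ℤ) by push_cast; ring] at h2
      have h3 := urnColour_add (k := k) (i := j) (r := r) (by omega)
      rw [h.code_eq_of_reflTransGen hk hf hw (by omega) h2, h3]
  · rintro ⟨w, hw, rfl, rfl, rfl⟩
    refine ⟨⟨w, hw, rfl, rfl⟩, ?_⟩
    by_cases hc : urnColour k (code k f w) = 0
    · exact Or.inl ⟨by rw [urnParent_eq_zero_iff.2 hc]; rfl, hc⟩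
    · have h1 := h.isChild_root hk hw ((hf.isCode hk).le w hw) hc
      have h2 := isAncestor_of_reflTransGen (.single h1) (h.reflTransGen_code hk hf hw hc)
      have h3 : urnColour k (code k f w) < k := Nat.mod_lt _ hk
      have h4 := mt urnParent_eq_zero_iff.1 hc
      refine Or.inr ⟨by omega, by omega, by omega, ?_⟩
      rw [ballVertex_succ]
      convert h2 using 1
      obtain ⟨j, r, he, h0, hr⟩ := exists_eq_of_colour hk hc
      rw [he, urnParent_add h0 hr, urnColour_add hr]
      push_cast
      ring

theorem IsLocalForest.mem_comp_zero (hp : 0 < p) (hk : 0 < k) (hf : IsUrnFun p k f)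
    (h : IsLocalForest p k f F) (u : ℤ) : u ∈ (comp F 0).verts ↔
      u = 0 ∨ ∃ v < p, u = ((v * k + 1 : ℕ) : ℤ) ∧ urnColour k (code k f v) = 0 := by
  rw [mem_comp]
  constructor
  · intro hu
    by_cases hu0 : u ≤ 0
    · exact Or.inl (h.root_unique hk hf (by simp [rt]) hu0 hu (Reachable.refl u)).symm
    · have huF := mem_verts_of_reachable hu (by simp only [rt]; omega)
      rw [h.verts] at huF
      obtain ⟨a, ha⟩ := exists_forestChild f hp hk (not_le.1 hu0) huF.2
      have hc := (h.child _ _).2 ha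
      rcases ha with ⟨v, hv, rfl, rfl⟩ | ⟨i, r, hi, hr, hrk, rfl, rfl⟩
      · have := h.root_eq hk hf hv le_rfl hu
        exact Or.inr ⟨v, hv, rfl, urnParent_eq_zero_iff.1 (by omega)⟩
      -- A coloured vertex is a child of a root symbol, so it is not in the component of `0`.
      · have := h.root_unique hk hf (by simp [rt]) (by omega) hu hc.reachable
        simp only [rt] at this
        omega
  · rintro (rfl | ⟨v, hv, rfl, hc⟩)
    · exact Reachable.refl _
    · have := reflTransGen_isChild_reachable (h.reflTransGen_root hk hf hv)
      rwa [urnParent_eq_zero_iff.2 hc] at this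

theorem IsLocalForest.isCodeOf_xi (hp : 0 < p) (hk : 0 < k) (hf : IsUrnFun p k f)
    (h : IsLocalForest p k f F) : IsCodeOf p k (code k f) (Xi p k F) where
  tree_verts := rfl
  tree_child a b := by
    rw [← h.omegaEdge_iff hk hf]
    have hlt : ∀ {i v}, OmegaEdge p k F i v → i < v := by
      intro i v he
      obtain ⟨w, hw, rfl, rfl⟩ := (h.omegaEdge_iff hk hf _ _).1 he
      have := urnParent_le hk ((hf.isCode hk).le w hw)
      omega
    constructor
    · rintro ⟨⟨-, h1 | h1⟩, h2⟩
      · exact h1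
      · exact absurd (hlt h1) h2.not_gt
    · intro h1
      exact ⟨⟨(hlt h1).ne, Or.inl h1⟩, hlt h1⟩
  colour e r := by
    -- `OmegaColouring` picks some colour; uniqueness makes its value known.
    have huniq : ∀ r r' : ℕ, (∃ i v : ℤ, e = s(i, v) ∧ OmegaColour p k F i v r) →
        (∃ i v : ℤ, e = s(i, v) ∧ OmegaColour p k F i v r') → r = r' := by
      rintro r r' ⟨i, v, rfl, h1⟩ ⟨i', v', he, h2⟩
      obtain ⟨w, hw, rfl, rfl, rfl⟩ := (h.omegaColour_iff hk hf _ _ _).1 h1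
      obtain ⟨w', hw', rfl, rfl, rfl⟩ := (h.omegaColour_iff hk hf _ _ _).1 h2
      have h3 := urnParent_le hk ((hf.isCode hk).le w hw)
      have h4 := urnParent_le hk ((hf.isCode hk).le w' hw')
      rcases Sym2.eq_iff.1 he with ⟨-, h5⟩ | ⟨h5, h6⟩
      · obtain rfl : w = w' := by omega
        rfl
      · omega
    have hspec : OmegaColouring p k F e = some r ↔
        ∃ i v : ℤ, e = s(i, v) ∧ OmegaColour p k F i v r := by
      unfold OmegaColouring
      split_ifs with hex
      · rw [Option.some_inj]
        refine ⟨fun h1 => h1 ▸ hex.choose_spec, fun h1 => huniq _ _ hex.choose_spec h1⟩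
      · exact iff_of_false (by simp) fun h1 => hex ⟨r, h1⟩
    refine hspec.trans ⟨?_, ?_⟩
    · rintro ⟨i, v, rfl, h1⟩
      obtain ⟨w, hw, rfl, rfl, rfl⟩ := (h.omegaColour_iff hk hf _ _ _).1 h1
      exact ⟨w, hw, rfl, rfl⟩
    · rintro ⟨w, hw, rfl, rfl⟩
      exact ⟨_, _, rfl, (h.omegaColour_iff hk hf _ _ _).2 ⟨w, hw, rfl, rfl, rfl⟩⟩
  star_verts := h.mem_comp_zero hp hk hf
  star_child a b := by
    refine isChild_comp.trans ⟨?_, ?_⟩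
    · rintro ⟨h1, h2⟩
      have hb := (((h.child _ _).1 h2).bounds hf).2.2.1
      rcases (h.mem_comp_zero hp hk hf b).1 (h1.trans h2.reachable) with h3 | ⟨v, hv, rfl, hc⟩
      · omega
      · refine ⟨v, hv, rfl, hc, ?_⟩
        rw [h.parent_ball hk hv h2, hf.code_colour_zero hk hv hc]
    · rintro ⟨v, hv, rfl, hc, rfl⟩
      have h1 := h.isChild_ball hv
      have h2 := (h.mem_comp_zero hp hk hf _).2 (Or.inr ⟨v, hv, rfl, hc⟩)
      rw [hf.code_colour_zero hk hv hc] at h1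
      exact ⟨(mem_comp.1 h2).trans h1.reachable.symm, h1⟩

end Xi

/-! ### Counting codes by their degrees -/

open Classical in
/-- The values `n` by which a code `g` of length `p` can be extended. -/
noncomputable def extensions (k p : ℕ) (g : ℕ → ℕ) : Finset ℕ :=
  (Finset.range (p * k + 1)).filter fun n =>
    ∀ u, n = u * k + 1 → urnColour k (g u) = 0 ∧ ∀ v < p, g v ≠ n

open Classical in
/-- The codes of length `p`. -/
noncomputable def codes (k : ℕ) : ℕ → Finset (ℕ → ℕ)
  | 0 => {0}
  | p + 1 => (codes k p).biUnion fun g => (extensions k p g).image (Function.update g p)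

/-- The number of children of `0` in the tree `T` with the code `g`. -/
def rootDegree (k p : ℕ) (g : ℕ → ℕ) : ℕ :=
  ((Finset.range p).filter fun v => urnColour k (g v) = 0).card

/-- The number of children of `0` in the tree `S_0` of the triple with the code `g`. -/
def starDegree (p : ℕ) (g : ℕ → ℕ) : ℕ :=
  ((Finset.range p).filter fun v => g v = 0).card

section Count

variable {p k : ℕ}

theorem mem_extensions {g : ℕ → ℕ} {n : ℕ} : n ∈ extensions k p g ↔ n ≤ p * k ∧
    ∀ u, n = u * k + 1 → urnColour k (g u) = 0 ∧ ∀ v < p, g v ≠ n := by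
  simp [extensions]

theorem IsCode.update {g : ℕ → ℕ} {n : ℕ} (hg : IsCode p k g)
    (hn : n ∈ extensions k p g) : IsCode (p + 1) k (Function.update g p n) := by
  rw [mem_extensions] at hn
  have h1 : ∀ v < p, Function.update g p n v = g v := fun v hv =>
    Function.update_of_ne hv.ne _ _
  have h2 : Function.update g p n p = n := Function.update_self _ _ _
  refine ⟨fun v hv => ?_, fun v hv w hw u h h' => ?_, fun v hv u h => ?_, fun v hv => ?_⟩
  · rcases Nat.lt_succ_iff_lt_or_eq.1 hv with hv | rfl
    · rw [h1 v hv]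
      exact hg.le v hv
    · rw [h2]
      exact hn.1
  · rcases Nat.lt_succ_iff_lt_or_eq.1 hv with hv | rfl <;>
    rcases Nat.lt_succ_iff_lt_or_eq.1 hw with hw | rfl
    · rw [h1 v hv] at h
      rw [h1 w hw] at h'
      exact hg.inj v hv w hw u h h'
    · rw [h1 v hv] at h
      rw [h2] at h'
      exact absurd (h.trans h'.symm) ((hn.2 u h').2 v hv)
    · rw [h2] at h
      rw [h1 w hw] at h'
      exact absurd (h'.trans h.symm) ((hn.2 u h).2 w hw)
    · rfl
  · rcases Nat.lt_succ_iff_lt_or_eq.1 hv with hv | rfl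
    · rw [h1 v hv] at h
      rw [h1 u ((lt_of_ball_le (h ▸ hg.le v hv)).trans hv)]
      exact hg.closed v hv u h
    · rw [h2] at h
      rw [h1 u (lt_of_ball_le (h ▸ hn.1))]
      exact (hn.2 u h).1
  · rw [Function.update_of_ne (by omega)]
    exact hg.zero v (by omega)

theorem IsCode.restrict {g : ℕ → ℕ} (hg : IsCode (p + 1) k g) :
    IsCode p k (Function.update g p 0) ∧ g p ∈ extensions k p (Function.update g p 0) := by
  have h1 : ∀ v < p, Function.update g p 0 v = g v := fun v hv =>
    Function.update_of_ne hv.ne _ _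
  refine ⟨⟨fun v hv => ?_, fun v hv w hw u h h' => ?_, fun v hv u h => ?_, fun v hv => ?_⟩, ?_⟩
  · rw [h1 v hv]
    exact hg.le v (by omega)
  · rw [h1 v hv] at h
    rw [h1 w hw] at h'
    exact hg.inj v (by omega) w (by omega) u h h'
  · rw [h1 v hv] at h
    rw [h1 u ((lt_of_ball_le (h ▸ hg.le v (by omega))).trans hv)]
    exact hg.closed v (by omega) u h
  · rcases hv.eq_or_lt with rfl | hv
    · exact Function.update_self _ _ _
    · rw [Function.update_of_ne hv.ne']
      exact hg.zero v hv
  · rw [mem_extensions]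
    refine ⟨hg.le p (by omega), fun u h => ⟨?_, fun v hv h' => ?_⟩⟩
    · rw [h1 u (lt_of_ball_le (h ▸ hg.le p (by omega)))]
      exact hg.closed p (by omega) u h
    · rw [h1 v hv] at h'
      exact hv.ne (hg.inj v (by omega) p (by omega) u (h'.trans h) h)

theorem mem_codes {g : ℕ → ℕ} : g ∈ codes k p ↔ IsCode p k g := by
  induction p generalizing g with
  | zero =>
    rw [codes, Finset.mem_singleton]
    constructor
    · rintro rfl
      exact ⟨by omega, by omega, by omega, fun _ _ => rfl⟩
    · intro h
      ext v
      exact h.zero v (Nat.zero_le v)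
  | succ p ih =>
    simp only [codes, Finset.mem_biUnion, Finset.mem_image]
    constructor
    · rintro ⟨g', hg', n, hn, rfl⟩
      exact (ih.1 hg').update hn
    · intro hg
      obtain ⟨h1, h2⟩ := hg.restrict
      exact ⟨_, ih.2 h1, _, h2, by simp⟩

theorem card_range_filter_colour_ne (hk : 0 < k) :
    ((Finset.range (p * k + 1)).filter fun n => urnColour k n ≠ 0).card = p * (k - 1) := by
  have h : ((Finset.range (p * k + 1)).filter fun n => urnColour k n ≠ 0) =
      (Finset.range p ×ˢ Finset.Ico 1 k).image fun x => x.1 * k + x.2 + 1 := by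
    ext n
    simp only [Finset.mem_filter, Finset.mem_range, Finset.mem_image, Finset.mem_product,
      Finset.mem_Ico, Prod.exists]
    constructor
    · rintro ⟨hn, hc⟩
      obtain ⟨i, r, rfl, h0, hr⟩ := exists_eq_of_colour hk hc
      exact ⟨i, r, ⟨lt_of_mul_lt_mul_right (a := k) (by omega) (Nat.zero_le _), by omega, hr⟩, rfl⟩
    · rintro ⟨i, r, ⟨hi, hr1, hr⟩, rfl⟩
      have := ball_le_of_lt hk hi
      have h2 := Nat.mul_le_mul_right k (Nat.succ_le_of_lt hi)
      rw [Nat.succ_mul] at h2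
      exact ⟨by omega, by rw [urnColour_add hr]; omega⟩
  rw [h, Finset.card_image_of_injOn, Finset.card_product, Finset.card_range, Nat.card_Ico]
  rintro ⟨i, r⟩ hx ⟨j, s⟩ hy he
  simp only [Finset.coe_product, Set.mem_prod, Finset.mem_coe, Finset.mem_Ico] at hx hy he
  obtain ⟨rfl, rfl⟩ := mul_add_unique (i := i) (j := j) hx.2.2 hy.2.2 (by omega)
  rfl

/-- The admissible ball vertices are the leaves of `S_0` other than `0`. Taking parents matches the
vertices with nonzero parent to the nonzero vertices that have a child, so the leaves are as many as
the children of `0`. -/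
theorem IsCode.card_extensions_ball (hk : 0 < k) {g : ℕ → ℕ} (hg : IsCode p k g) :
    ((extensions k p g).filter fun n => urnColour k n = 0 ∧ n ≠ 0).card = starDegree p g := by
  classical
  set Z := (Finset.range p).filter fun v => urnColour k (g v) = 0 with hZ
  have hmemZ : ∀ v, v ∈ Z ↔ v < p ∧ urnColour k (g v) = 0 := fun v => by simp [hZ]
  have h1 : (extensions k p g).filter (fun n => urnColour k n = 0 ∧ n ≠ 0) =
      (Z.filter fun u => ¬ ∃ v < p, g v = u * k + 1).image fun u => u * k + 1 := by
    ext n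
    simp only [Finset.mem_filter, mem_extensions, Finset.mem_image, hmemZ]
    constructor
    · rintro ⟨⟨hn, hu⟩, hc, hn0⟩
      rcases urn_cases k n with h | ⟨u, rfl⟩ | h
      · exact absurd h hn0
      · obtain ⟨h2, h3⟩ := hu u rfl
        exact ⟨u, ⟨⟨lt_of_ball_le hn, h2⟩, fun ⟨v, hv, he⟩ => h3 v hv he⟩, rfl⟩
      · exact absurd hc h
    · rintro ⟨u, ⟨⟨hu, hc⟩, hne⟩, rfl⟩
      refine ⟨⟨ball_le_of_lt hk hu, fun w hw => ?_⟩, urnColour_ball k u, by omega⟩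
      obtain rfl := ball_injective hk hw
      exact ⟨hc, fun v hv he => hne ⟨v, hv, he⟩⟩
  have h2 : (Z.filter fun u => ∃ v < p, g v = u * k + 1) =
      (Z.filter fun v => ¬ g v = 0).image fun v => (g v - 1) / k := by
    ext u
    simp only [Finset.mem_filter, Finset.mem_image, hmemZ]
    constructor
    · rintro ⟨-, v, hv, he⟩
      exact ⟨v, ⟨⟨hv, by rw [he, urnColour_ball]⟩, by omega⟩, by simp [he, hk]⟩
    · rintro ⟨v, ⟨⟨hv, hc⟩, h0⟩, rfl⟩
      rcases urn_cases k (g v) with h | ⟨u, h⟩ | h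
      · exact absurd h h0
      · have h3 : (g v - 1) / k = u := by simp [h, hk]
        rw [h3]
        exact ⟨⟨(lt_of_ball_le (h ▸ hg.le v hv)).trans hv, hg.closed v hv u h⟩, v, hv, h⟩
      · exact absurd hc h
  have h3 : ((Z.filter fun v => ¬ g v = 0).image fun v => (g v - 1) / k).card =
      (Z.filter fun v => ¬ g v = 0).card := by
    refine Finset.card_image_of_injOn fun v hv w hw he => ?_
    simp only [Finset.coe_filter, Set.mem_ofPred_eq, hmemZ] at hv hw he
    rcases urn_cases k (g v) with h | ⟨x, h⟩ | h
    · exact absurd h hv.2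
    · rcases urn_cases k (g w) with h' | ⟨y, h'⟩ | h'
      · exact absurd h' hw.2
      · rw [show (g v - 1) / k = x by simp [h, hk], show (g w - 1) / k = y by simp [h', hk]] at he
        exact hg.inj v hv.1.1 w hw.1.1 x h (by rw [h', he])
      · exact absurd hw.1.2 h'
    · exact absurd hv.1.2 h
  have h4 : (Z.filter fun v => g v = 0).card = starDegree p g := by
    rw [starDegree]
    congr 1
    ext v
    simp only [Finset.mem_filter, hmemZ, Finset.mem_range]
    refine ⟨fun h => ⟨h.1.1, h.2⟩, fun h => ⟨⟨h.1, ?_⟩, h.2⟩⟩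
    rw [h.2, urnColour_zero]
  have h5 := Finset.card_filter_add_card_filter_not (s := Z) (fun u => ∃ v < p, g v = u * k + 1)
  have h6 := Finset.card_filter_add_card_filter_not (s := Z) (fun v => g v = 0)
  rw [h1, Finset.card_image_of_injective _ fun u w h => ball_injective hk h]
  rw [h2, h3] at h5
  omega

theorem rootDegree_update {g : ℕ → ℕ} {n : ℕ} :
    rootDegree k (p + 1) (Function.update g p n) =
      rootDegree k p g + if urnColour k n = 0 then 1 else 0 := by
  have h : (Finset.range p).filter (fun v => urnColour k (Function.update g p n v) = 0) =
      (Finset.range p).filter (fun v => urnColour k (g v) = 0) := by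
    refine Finset.filter_congr fun v hv => ?_
    rw [Function.update_of_ne (Finset.mem_range.1 hv).ne]
  rw [rootDegree, rootDegree, Finset.range_add_one, Finset.filter_insert, Function.update_self, h]
  split_ifs
  · rw [Finset.card_insert_of_notMem (by simp)]
  · rfl

theorem starDegree_update {g : ℕ → ℕ} {n : ℕ} :
    starDegree (p + 1) (Function.update g p n) =
      starDegree p g + if n = 0 then 1 else 0 := by
  have h : (Finset.range p).filter (fun v => Function.update g p n v = 0) =
      (Finset.range p).filter (fun v => g v = 0) := by
    refine Finset.filter_congr fun v hv => ?_
    rw [Function.update_of_ne (Finset.mem_range.1 hv).ne]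
  rw [starDegree, starDegree, Finset.range_add_one, Finset.filter_insert, Function.update_self, h]
  split_ifs
  · rw [Finset.card_insert_of_notMem (by simp)]
  · rfl

/-- A coloured value changes neither degree, `0` raises both, and a leaf of `S_0` raises only the
root degree. The weight `w` becomes the indicator of a pair of degrees in `card_codes`. -/
theorem IsCode.sum_extensions (hk : 0 < k) {g : ℕ → ℕ} (hg : IsCode p k g) (w : ℕ → ℕ → ℕ) :
    ∑ n ∈ extensions k p g, w (rootDegree k (p + 1) (Function.update g p n))
        (starDegree (p + 1) (Function.update g p n)) =
      p * (k - 1) * w (rootDegree k p g) (starDegree p g) +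
        w (rootDegree k p g + 1) (starDegree p g + 1) +
        starDegree p g * w (rootDegree k p g + 1) (starDegree p g) := by
  simp only [rootDegree_update, starDegree_update]
  rw [← Finset.sum_filter_add_sum_filter_not _ (fun n => urnColour k n = 0),
    ← Finset.sum_filter_add_sum_filter_not ((extensions k p g).filter fun n => urnColour k n = 0)
      (fun n => n = 0)]
  have h1 : ((extensions k p g).filter fun n => urnColour k n = 0).filter (fun n => n = 0) =
      {0} := by
    ext n
    simp only [Finset.mem_filter, mem_extensions, Finset.mem_singleton]
    refine ⟨fun h => h.2, ?_⟩
    rintro rfl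
    exact ⟨⟨⟨Nat.zero_le _, fun u h => by omega⟩, urnColour_zero k⟩, rfl⟩
  have h2 : (extensions k p g).filter (fun n => ¬ urnColour k n = 0) =
      (Finset.range (p * k + 1)).filter fun n => urnColour k n ≠ 0 := by
    ext n
    simp only [Finset.mem_filter, mem_extensions, Finset.mem_range, Nat.lt_succ_iff]
    refine ⟨fun h => ⟨h.1.1, h.2⟩, fun h => ⟨⟨h.1, fun u hu => ?_⟩, h.2⟩⟩
    exact absurd (by rw [hu, urnColour_ball]) h.2
  have h3 : ∑ n ∈ (extensions k p g).filter (fun n => ¬ urnColour k n = 0),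
      w (rootDegree k p g + if urnColour k n = 0 then 1 else 0)
        (starDegree p g + if n = 0 then 1 else 0) =
      p * (k - 1) * w (rootDegree k p g) (starDegree p g) := by
    rw [h2, Finset.sum_congr rfl (g := fun _ => w (rootDegree k p g) (starDegree p g)),
      Finset.sum_const, card_range_filter_colour_ne hk, smul_eq_mul]
    intro n hn
    have hc := (Finset.mem_filter.1 hn).2
    have hn0 : n ≠ 0 := by
      rintro rfl
      exact hc (urnColour_zero k)
    rw [if_neg hc, if_neg hn0, add_zero, add_zero]
  have h4 : ∑ n ∈ ((extensions k p g).filter fun n => urnColour k n = 0).filter (fun n => ¬ n = 0),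
      w (rootDegree k p g + if urnColour k n = 0 then 1 else 0)
        (starDegree p g + if n = 0 then 1 else 0) =
      starDegree p g * w (rootDegree k p g + 1) (starDegree p g) := by
    rw [Finset.filter_filter,
      Finset.sum_congr rfl (g := fun _ => w (rootDegree k p g + 1) (starDegree p g)),
      Finset.sum_const, hg.card_extensions_ball hk, smul_eq_mul]
    intro n hn
    obtain ⟨-, hc, hn0⟩ := Finset.mem_filter.1 hn
    rw [if_pos hc, if_neg hn0, add_zero]
  rw [h1, h3, h4, Finset.sum_singleton, if_pos (urnColour_zero k), if_pos rfl]
  ring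

theorem sum_codes_succ (hk : 0 < k) (w : ℕ → ℕ → ℕ) :
    ∑ g ∈ codes k (p + 1), w (rootDegree k (p + 1) g) (starDegree (p + 1) g) =
      ∑ g ∈ codes k p, (p * (k - 1) * w (rootDegree k p g) (starDegree p g) +
        w (rootDegree k p g + 1) (starDegree p g + 1) +
        starDegree p g * w (rootDegree k p g + 1) (starDegree p g)) := by
  classical
  rw [codes, Finset.sum_biUnion]
  · refine Finset.sum_congr rfl fun g hg => ?_
    rw [Finset.sum_image fun n _ m _ h => Function.update_injective g p h,
      (mem_codes.1 hg).sum_extensions hk]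
  -- Codes of length `p` vanish at `p`, so an extension determines the code it extends.
  · intro g hg g' hg' hne
    rw [Function.onFun, Finset.disjoint_left]
    intro h h1 h2
    obtain ⟨n, -, rfl⟩ := Finset.mem_image.1 h1
    obtain ⟨m, -, he⟩ := Finset.mem_image.1 h2
    apply hne
    ext v
    rcases eq_or_ne v p with rfl | hv
    · rw [(mem_codes.1 hg).zero v le_rfl, (mem_codes.1 hg').zero v le_rfl]
    · have := congrFun he v
      rw [Function.update_of_ne hv, Function.update_of_ne hv] at this
      exact this.symm

/-- For positive degrees the extension count reads `c(p+1,j+1,m+1) = p(k-1) c(p,j+1,m+1) + c(p,j,m)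
+ (m+1) c(p,j,m+1)`. The last two terms merge by the recurrence of the second kind, and the total by
that of the first kind. -/
theorem card_codes (hk : 0 < k) (p j m : ℕ) :
    ((codes k p).filter fun g => rootDegree k p g = j ∧ starDegree p g = m).card =
      Nat.stirlingFirst p j * Nat.stirlingSecond j m * (k - 1) ^ (p - j) := by
  induction p generalizing j m with
  | zero =>
    rw [codes, Finset.filter_singleton]
    rcases j with - | j <;> rcases m with - | m <;> simp [rootDegree, starDegree]
  | succ p ih =>
    simp only [Finset.card_filter] at ih ⊢
    rw [sum_codes_succ hk (fun j' m' => if j' = j ∧ m' = m then 1 else 0)]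
    rw [Finset.sum_add_distrib, Finset.sum_add_distrib, ← Finset.mul_sum, ih]
    rcases j with - | j
    · rcases p with - | p <;> simp
    have hpow : p * (k - 1) * (Nat.stirlingFirst p (j + 1) * Nat.stirlingSecond (j + 1) m *
        (k - 1) ^ (p - (j + 1))) =
        p * Nat.stirlingFirst p (j + 1) * Nat.stirlingSecond (j + 1) m * (k - 1) ^ (p - j) := by
      -- For `j ≥ p` truncated subtraction spoils the exponents, but then the Stirling number is
      -- `0`.
      rcases lt_or_ge j p with h | h
      · rw [show p - j = p - (j + 1) + 1 by omega, pow_succ]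
        ring
      · rw [Nat.stirlingFirst_eq_zero_of_lt (by omega)]
        simp
    have hstar : ∀ m', ∑ g ∈ codes k p, starDegree p g *
        (if rootDegree k p g + 1 = j + 1 ∧ starDegree p g = m' then 1 else 0) =
        m' * ∑ g ∈ codes k p, if rootDegree k p g = j ∧ starDegree p g = m' then 1 else 0 := by
      intro m'
      rw [Finset.mul_sum]
      refine Finset.sum_congr rfl fun g _ => ?_
      simp only [Nat.add_right_cancel_iff]
      split_ifs with h
      · rw [h.2]
      · simp
    rw [hpow, hstar, ih, Nat.stirlingFirst_succ_succ, Nat.add_sub_add_right]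
    rcases m with - | m
    · simp
    · simp only [Nat.add_right_cancel_iff]
      rw [ih, Nat.stirlingSecond_succ_succ]
      ring

theorem card_codes_starDegree (hk : 0 < k) (p m : ℕ) :
    ((codes k p).filter fun g => starDegree p g = m).card =
      ∑ j ∈ Finset.range (p + 1),
        Nat.stirlingFirst p j * Nat.stirlingSecond j m * (k - 1) ^ (p - j) := by
  rw [Finset.card_eq_sum_card_fiberwise (f := rootDegree k p) (t := Finset.range (p + 1))]
  · refine Finset.sum_congr rfl fun j _ => ?_
    rw [← card_codes hk, Finset.filter_filter]
    simp only [and_comm]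
  · intro g _
    rw [Finset.mem_coe, Finset.mem_range, Nat.lt_succ_iff]
    exact (Finset.card_filter_le _ _).trans (Finset.card_range p).le

end Count

/-! ### The coefficients of `(x^k D)^p` -/

/-- The closed formula for the number of distributions with `m` balls in `x_0`. -/
def stirlingSum (q p m : ℕ) : ℕ :=
  ∑ j ∈ Finset.range (p + 1), Nat.stirlingFirst p j * Nat.stirlingSecond j m * q ^ (p - j)

theorem stirlingSum_succ_zero (q p : ℕ) : stirlingSum q (p + 1) 0 = 0 := by
  refine Finset.sum_eq_zero fun j _ => ?_
  rcases j with - | j <;> simp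

theorem stirlingSum_eq_zero {q p m : ℕ} (h : p < m) : stirlingSum q p m = 0 := by
  refine Finset.sum_eq_zero fun j hj => ?_
  rw [Finset.mem_range] at hj
  rw [Nat.stirlingSecond_eq_zero_of_lt (by omega)]
  simp

theorem stirlingSum_succ_succ (q p m : ℕ) :
    stirlingSum q (p + 1) (m + 1) =
      stirlingSum q p m + (p * q + (m + 1)) * stirlingSum q p (m + 1) := by
  have h : ∀ j ∈ Finset.range (p + 1), Nat.stirlingFirst (p + 1) (j + 1) *
      Nat.stirlingSecond (j + 1) (m + 1) * q ^ (p + 1 - (j + 1)) =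
      p * q * (Nat.stirlingFirst p (j + 1) * Nat.stirlingSecond (j + 1) (m + 1) *
        q ^ (p - (j + 1))) +
      (Nat.stirlingFirst p j * Nat.stirlingSecond j m * q ^ (p - j) +
        (m + 1) * (Nat.stirlingFirst p j * Nat.stirlingSecond j (m + 1) * q ^ (p - j))) := by
    intro j hj
    rw [Nat.stirlingFirst_succ_succ, Nat.add_sub_add_right, add_mul, add_mul]
    congr 1
    · rcases lt_or_ge j p with h | h
      · rw [show p - j = p - (j + 1) + 1 by omega, pow_succ]
        ring
      · rw [Nat.stirlingFirst_eq_zero_of_lt (by omega)]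
        simp
    · rw [Nat.stirlingSecond_succ_succ]
      ring
  have h' : ∑ j ∈ Finset.range (p + 1), Nat.stirlingFirst p (j + 1) *
      Nat.stirlingSecond (j + 1) (m + 1) * q ^ (p - (j + 1)) = stirlingSum q p (m + 1) := by
    rw [stirlingSum, Finset.sum_range_succ, Finset.sum_range_succ' _ p,
      Nat.stirlingFirst_eq_zero_of_lt (by omega : p < p + 1)]
    simp
  rw [stirlingSum, Finset.sum_range_succ', Finset.sum_congr rfl h, Finset.sum_add_distrib,
    Finset.sum_add_distrib, ← Finset.mul_sum, ← Finset.mul_sum, h']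
  simp only [stirlingSum, Nat.stirlingFirst_succ_zero]
  ring

theorem stirlingSum_eq_sum_Icc (q p m : ℕ) : stirlingSum q p m =
    ∑ j ∈ Finset.Icc m p, Nat.stirlingFirst p j * Nat.stirlingSecond j m * q ^ (p - j) := by
  refine (Finset.sum_subset (fun j hj => ?_) fun j hj hj' => ?_).symm
  · rw [Finset.mem_range]
    have := (Finset.mem_Icc.1 hj).2
    omega
  · rw [Finset.mem_range] at hj
    rw [Finset.mem_Icc] at hj'
    rw [Nat.stirlingSecond_eq_zero_of_lt (by omega)]
    simp

theorem xkD_term (q N m : ℕ) (a : ℝ) (f : ℝ[X]) :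
    xkD (q + 1) (X ^ N * (C a * X ^ m * derivative^[m] f)) =
      X ^ (N + q) * (C (((N + m : ℕ) : ℝ) * a) * X ^ m * derivative^[m] f +
        C a * X ^ (m + 1) * derivative^[m + 1] f) := by
  have h1 : X ^ (q + 1) * derivative (X ^ (N + m) : ℝ[X]) =
      C ((N + m : ℕ) : ℝ) * X ^ (N + m + q) := by
    rw [derivative_X_pow]
    rcases h : N + m with - | n
    · simp
    · rw [Nat.add_sub_cancel]
      ring
  have h2 : X ^ N * (C a * X ^ m * derivative^[m] f) =
      C a * (X ^ (N + m) * derivative^[m] f) := by ring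
  rw [xkD, h2, derivative_C_mul, derivative_mul, Function.iterate_succ_apply', C_mul]
  linear_combination C a * derivative^[m] f * h1

theorem iterate_xkD (q p : ℕ) (f : ℝ[X]) : (xkD (q + 1))^[p] f =
    X ^ (p * q) * ∑ m ∈ Finset.range (p + 1),
      C (stirlingSum q p m : ℝ) * X ^ m * derivative^[m] f := by
  induction p with
  | zero => simp [stirlingSum]
  | succ p ih =>
    have hlin : ∀ s : Finset ℕ, ∀ u : ℕ → ℝ[X],
        xkD (q + 1) (∑ m ∈ s, u m) = ∑ m ∈ s, xkD (q + 1) (u m) := by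
      intro s u
      simp only [xkD, derivative_sum, Finset.mul_sum]
    rw [Function.iterate_succ_apply', ih, Finset.mul_sum, hlin,
      Finset.sum_congr rfl fun m _ => xkD_term q (p * q) m (stirlingSum q p m) f,
      ← Finset.mul_sum, add_mul p 1 q, one_mul]
    congr 1
    rw [Finset.sum_range_succ' _ (p + 1), Finset.sum_add_distrib]
    -- The index shift is free: the term `m = 0` vanishes, by the factor `p` or by
    -- `stirlingSum_succ_zero`, and so does the added term `m = p + 1`.
    have h1 : ∑ m ∈ Finset.range (p + 1), C (((p * q + m : ℕ) : ℝ) * (stirlingSum q p m : ℝ)) *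
        X ^ m * derivative^[m] f = ∑ m ∈ Finset.range (p + 1),
        C (((p * q + (m + 1) : ℕ) : ℝ) * (stirlingSum q p (m + 1) : ℝ)) *
        X ^ (m + 1) * derivative^[m + 1] f := by
      have h0 : p * q * stirlingSum q p 0 = 0 := by
        rcases p with - | p
        · simp
        · rw [stirlingSum_succ_zero, mul_zero]
      rw [Finset.sum_range_succ' _ p, Finset.sum_range_succ _ p,
        stirlingSum_eq_zero (Nat.lt_succ_self p), add_zero (p * q), ← Nat.cast_mul (p * q), h0]
      simp
    rw [h1, ← Finset.sum_add_distrib, stirlingSum_succ_zero, Nat.cast_zero, C_0, zero_mul,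
      zero_mul, add_zero]
    refine Finset.sum_congr rfl fun m _ => ?_
    rw [stirlingSum_succ_succ, Nat.cast_add (stirlingSum q p m), Nat.cast_mul, C_add]
    ring

/-- Testing on `x^n` gives a triangular system: `D^m x^n = 0` for `m > n`, smaller `m` drop out by
induction, and `n! d_n = 0` remains. -/
theorem expansion_coeff_unique {p : ℕ} {d : ℕ → ℝ}
    (h : ∀ f : ℝ[X], ∑ m ∈ Finset.Icc 1 p, C (d m) * X ^ m * derivative^[m] f = 0) :
    ∀ m ∈ Finset.Icc 1 p, d m = 0 := by
  intro n
  induction n using Nat.strong_induction_on with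
  | _ n ih =>
  intro hn
  have h1 := h (X ^ n)
  rw [Finset.sum_eq_single n] at h1
  · rw [iterate_derivative_X_pow_eq_smul, Nat.descFactorial_self, Nat.sub_self, pow_zero] at h1
    have h2 := congrArg (fun g : ℝ[X] => g.coeff n) h1
    simpa [Nat.factorial_ne_zero, mul_assoc, coeff_X_pow] using h2
  · intro m hm hmn
    rcases lt_or_gt_of_ne hmn with hlt | hlt
    · rw [ih m hlt hm]
      simp
    · rw [iterate_derivative_X_pow_eq_smul, Nat.descFactorial_of_lt hlt]
      simp
  · exact fun h => absurd hn h

theorem isExpansion_iff {p k : ℕ} (hp : 0 < p) (hk : 0 < k) (a : ℕ → ℝ) :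
    IsExpansion p k a ↔ ∀ m ∈ Finset.Icc 1 p, a m = (stirlingSum (k - 1) p m : ℝ) := by
  obtain ⟨q, rfl⟩ : ∃ q, k = q + 1 := ⟨k - 1, by omega⟩
  rw [Nat.add_sub_cancel]
  have hrange : ∀ f : ℝ[X], (xkD (q + 1))^[p] f = X ^ (p * q) * ∑ m ∈ Finset.Icc 1 p,
      C (stirlingSum q p m : ℝ) * X ^ m * derivative^[m] f := by
    intro f
    rw [iterate_xkD, Finset.range_eq_Ico, Finset.sum_eq_sum_Ico_succ_bot (Nat.succ_pos p)]
    -- For `p > 0` the coefficient at `m = 0` is zero, so the sum may start at `1`.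
    obtain ⟨p', rfl⟩ : ∃ p', p = p' + 1 := ⟨p - 1, by omega⟩
    rw [stirlingSum_succ_zero, Nat.cast_zero, C_0, zero_mul, zero_mul, zero_add]
    rfl
  constructor
  · intro h m hm
    rw [← sub_eq_zero]
    refine expansion_coeff_unique (d := fun m => a m - (stirlingSum q p m : ℝ)) (fun f => ?_) m hm
    have h1 := (h f).symm.trans (hrange f)
    rw [Nat.add_sub_cancel] at h1
    have h2 := mul_left_cancel₀ (pow_ne_zero _ X_ne_zero) h1
    simp only [C_sub, sub_mul, Finset.sum_sub_distrib]
    exact sub_eq_zero.2 h2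
  · intro h f
    rw [hrange, Nat.add_sub_cancel]
    congr 1
    exact Finset.sum_congr rfl fun m hm => by rw [h m hm]

/-! ### Transfer from codes to forests, triples and distributions -/

section Main

variable {p k : ℕ}

theorem IsCodeOf.numChildren_tree {g : ℕ → ℕ} {t : Triple} (h : IsCodeOf p k g t) :
    numChildren t.T 0 = rootDegree k p g := by
  have h1 : {v : ℤ | IsChild t.T 0 v} = (fun v : ℕ => ((v + 1 : ℕ) : ℤ)) ''
      ((Finset.range p).filter fun v => urnColour k (g v) = 0 : Finset ℕ) := by
    ext b
    simp only [Set.mem_ofPred_eq, h.tree_child, Set.mem_image, Finset.coe_filter, Finset.mem_range]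
    constructor
    · rintro ⟨v, hv, rfl, h0⟩
      exact ⟨v, ⟨hv, urnParent_eq_zero_iff.1 (by omega)⟩, rfl⟩
    · rintro ⟨v, ⟨hv, hc⟩, rfl⟩
      exact ⟨v, hv, rfl, by rw [urnParent_eq_zero_iff.2 hc]; rfl⟩
  rw [numChildren, h1, Set.ncard_image_of_injective _ fun v w h => by simpa using h,
    Set.ncard_coe_finset, rootDegree]

theorem IsCodeOf.numChildren_star (hk : 0 < k) {g : ℕ → ℕ} {t : Triple}
    (h : IsCodeOf p k g t) : numChildren t.S 0 = starDegree p g := by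
  have h1 : {v : ℤ | IsChild t.S 0 v} = (fun v : ℕ => ((v * k + 1 : ℕ) : ℤ)) ''
      ((Finset.range p).filter fun v => g v = 0 : Finset ℕ) := by
    ext b
    simp only [Set.mem_ofPred_eq, h.star_child, Set.mem_image, Finset.coe_filter, Finset.mem_range]
    constructor
    · rintro ⟨v, hv, rfl, -, h0⟩
      exact ⟨v, ⟨hv, by omega⟩, rfl⟩
    · rintro ⟨v, ⟨hv, h0⟩, rfl⟩
      exact ⟨v, hv, rfl, by rw [h0, urnColour_zero], by rw [h0]; rfl⟩
  rw [numChildren, h1, Set.ncard_image_of_injective _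
    fun v w h => ball_injective hk (by exact_mod_cast h), Set.ncard_coe_finset, starDegree]

theorem IsForestOf.isCodeOf (hp : 0 < p) (hk : 0 < k) {d : Distribution p k} {F : Gr}
    (h : IsForestOf d F) : IsCodeOf p k (code k d.toFun) (Xi p k F) :=
  ((isForestOf_iff hp hk).1 h).isCodeOf_xi hp hk (d.isUrnFun hk)

theorem Distribution.eq_of_code_eq (hk : 0 < k) {d d' : Distribution p k}
    (h : code k d.toFun = code k d'.toFun) : d = d' :=
  Distribution.toFun_injective (code_injOn hk (d.isUrnFun hk) (d'.isUrnFun hk) h)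

theorem Distribution.existsUnique_forest (hp : 0 < p) (hk : 0 < k) (d : Distribution p k) :
    ∃! F, IsForestOf d F := by
  obtain ⟨F, hF⟩ := (d.isUrnFun hk).exists_isLocalForest
  exact ⟨F, (isForestOf_iff hp hk).2 hF, fun F' hF' => ((isForestOf_iff hp hk).1 hF').unique hF⟩

theorem eq_of_xi_eq (hp : 0 < p) (hk : 0 < k) {d d' : Distribution p k} {F F' : Gr}
    (h : IsForestOf d F) (h' : IsForestOf d' F') (he : Xi p k F = Xi p k F') : d = d' :=
  Distribution.eq_of_code_eq hk <| (h.isCodeOf hp hk).code_unique hk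
    ((d.isUrnFun hk).isCode hk) ((d'.isUrnFun hk).isCode hk) (he ▸ h'.isCodeOf hp hk)

theorem IsCode.exists_forest (hp : 0 < p) (hk : 0 < k) {g : ℕ → ℕ} (hg : IsCode p k g) :
    ∃ (d : Distribution p k) (F : Gr), IsForestOf d F ∧ code k d.toFun = g := by
  obtain ⟨f, hf, rfl⟩ := hg.exists_urnFun hk
  obtain ⟨d, rfl⟩ := hf.exists_distribution hk
  obtain ⟨F, hF, -⟩ := d.existsUnique_forest hp hk
  exact ⟨d, F, hF, rfl⟩

theorem bijOn_xi (hp : 0 < p) (hk : 0 < k) : Set.BijOn (Xi p k) (forests p k) (triples p k) := by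
  refine ⟨?_, ?_, ?_⟩
  · rintro F ⟨d, hF⟩
    exact (hF.isCodeOf hp hk).isTriple hk ((d.isUrnFun hk).isCode hk)
  · rintro F ⟨d, hF⟩ F' ⟨d', hF'⟩ he
    obtain rfl := eq_of_xi_eq hp hk hF hF' he
    exact (d.existsUnique_forest hp hk).unique hF hF'
  · intro t ht
    obtain ⟨g, hg, hgt⟩ := IsTriple.exists_code hk ht
    obtain ⟨d, F, hF, rfl⟩ := hg.exists_forest hp hk
    exact ⟨F, ⟨d, hF⟩, (hF.isCodeOf hp hk).triple_unique hgt⟩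

theorem ncard_triples (hp : 0 < p) (hk : 0 < k) (j m : ℕ) :
    {t ∈ triples p k | numChildren t.T 0 = j ∧ numChildren t.S 0 = m}.ncard =
      Nat.stirlingFirst p j * Nat.stirlingSecond j m * (k - 1) ^ (p - j) := by
  rw [← card_codes hk, ← Set.ncard_coe_finset]
  have hex : ∀ g, IsCode p k g → ∃ t, IsCodeOf p k g t := by
    intro g hg
    obtain ⟨d, F, hF, rfl⟩ := hg.exists_forest hp hk
    exact ⟨_, hF.isCodeOf hp hk⟩
  -- A default for `choose!`, relevant only off the codes.
  have : Nonempty Triple := ⟨⟨⊥, fun _ => none, ⊥⟩⟩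
  choose! τ hτ using hex
  refine (Set.ncard_congr (fun g _ => τ g) ?_ ?_ ?_).symm
  · intro g hg
    rw [Finset.mem_coe, Finset.mem_filter, mem_codes] at hg
    obtain ⟨hg, rfl, rfl⟩ := hg
    exact ⟨(hτ g hg).isTriple hk hg, (hτ g hg).numChildren_tree, (hτ g hg).numChildren_star hk⟩
  · intro g g' hg hg' he
    rw [Finset.mem_coe, Finset.mem_filter, mem_codes] at hg hg'
    exact (hτ g hg.1).code_unique hk hg.1 hg'.1 (he ▸ hτ g' hg'.1)
  · rintro t ⟨ht, rfl, rfl⟩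
    obtain ⟨g, hg, hgt⟩ := IsTriple.exists_code hk ht
    refine ⟨g, ?_, (hτ g hg).triple_unique hgt⟩
    rw [Finset.mem_coe, Finset.mem_filter, mem_codes]
    exact ⟨hg, hgt.numChildren_tree.symm, (hgt.numChildren_star hk).symm⟩

theorem Distribution.starDegree_code (hk : 0 < k) (d : Distribution p k) :
    starDegree p (code k d.toFun) = d.ballsInZero := by
  rw [d.ballsInZero_eq, starDegree]
  congr 1
  exact Finset.filter_congr fun v hv =>
    (d.isUrnFun hk).code_eq_zero_iff hk (Finset.mem_range.1 hv)

theorem alpha_eq_stirlingSum (hp : 0 < p) (hk : 0 < k) (m : ℕ) :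
    alpha p k m = stirlingSum (k - 1) p m := by
  rw [stirlingSum, ← card_codes_starDegree hk, ← Set.ncard_coe_finset]
  refine Set.ncard_congr (fun d _ => code k d.toFun) ?_ ?_ ?_
  · intro d hd
    rw [Finset.mem_coe, Finset.mem_filter, mem_codes, d.starDegree_code hk]
    exact ⟨(d.isUrnFun hk).isCode hk, hd⟩
  · intro d d' _ _ h
    exact Distribution.eq_of_code_eq hk h
  · intro g hg
    rw [Finset.mem_coe, Finset.mem_filter, mem_codes] at hg
    obtain ⟨d, F, -, rfl⟩ := hg.1.exists_forest hp hk
    exact ⟨d, (d.starDegree_code hk).symm.trans hg.2, rfl⟩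

end Main

end PKForest

theorem mainTheorem4 (p k : ℕ) (hp : 0 < p) (hk : 0 < k) :
    -- (i) the map `Ξ` is a bijection from the forests onto the triples
    Set.BijOn (PKForest.Xi p k) (PKForest.forests p k) (PKForest.triples p k) ∧
    -- (ii) distributions and forests correspond bijectively to each other, and the number of balls
    -- in `x_0` becomes the number of children of `0` in `S_0`
    ((∀ d : PKForest.Distribution p k, ∃! F, PKForest.IsForestOf d F) ∧
      (∀ F ∈ PKForest.forests p k, ∃! d : PKForest.Distribution p k, PKForest.IsForestOf d F) ∧
      (∀ (d : PKForest.Distribution p k) (F : PKForest.Gr), PKForest.IsForestOf d F →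
        PKForest.numChildren (PKForest.Xi p k F).S 0 = d.ballsInZero)) ∧
    -- the number of triples in which `0` has `j` children in `T` and `m` children in `S_0`
    (∀ j m : ℕ, j ≤ p →
      {t ∈ PKForest.triples p k |
        PKForest.numChildren t.T 0 = j ∧ PKForest.numChildren t.S 0 = m}.ncard =
      Nat.stirlingFirst p j * Nat.stirlingSecond j m * (k - 1) ^ (p - j)) ∧
    -- `α_{pm}(k)` is the coefficient in the expansion of `(x^k D)^p`, and the resulting identity
    (∀ a : ℕ → ℝ, PKForest.IsExpansion p k a ↔
      ∀ m ∈ Finset.Icc 1 p, a m = (PKForest.alpha p k m : ℝ)) ∧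
    (∀ m : ℕ, PKForest.alpha p k m =
      ∑ j ∈ Finset.Icc m p, Nat.stirlingFirst p j * Nat.stirlingSecond j m * (k - 1) ^ (p - j)) := by
  refine ⟨PKForest.bijOn_xi hp hk, ⟨fun d => d.existsUnique_forest hp hk, ?_, ?_⟩,
    fun j m _ => PKForest.ncard_triples hp hk j m, fun a => ?_, fun m => ?_⟩
  · rintro F ⟨d, hF⟩
    exact ⟨d, hF, fun d' hF' => PKForest.eq_of_xi_eq hp hk hF' hF rfl⟩
  · intro d F hF
    rw [(hF.isCodeOf hp hk).numChildren_star hk, d.starDegree_code hk]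
  · simp only [PKForest.alpha_eq_stirlingSum hp hk, PKForest.isExpansion_iff hp hk]
  · rw [PKForest.alpha_eq_stirlingSum hp hk, PKForest.stirlingSum_eq_sum_Icc]
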